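/- **Theorem (Extended Computable Open Mapping Theorem).** Let $\hat{\mathbb C}=\mathbb C\cup\{\infty\}$ be the Riemann sphere. Call a subset of $\hat{\mathbb C}$ *basic* if it is an open rectangle $(a,b)\times(c,d)\subseteq\mathbb C$ with rational $a<b$, $c<d$, or the set $\hat{\mathbb C}\setminus\overline{D_r(0)}$ for a rational $r>0$, where $D_r(0)$ is the open disk of radius $r$ about $0$; basic sets are coded by natural numbers in a standard effective way, and a *list* of basic sets is an infinite sequence of such codes and blanks (the list may be empty, and the order is arbitrary). Names are defined as follows. * A *name* of a point $z\in\hat{\mathbb C}$ is a list of all basic sets that contain $z$. * A *name* of an open set $U\subseteq\hat{\mathbb C}$ is a list of all basic sets whose closures (in $\hat{\mathbb C}$) are contained in $U$. * A *name* of a function $f:D\to\hat{\mathbb C}$ with $D\subseteq\hat{\mathbb C}$ is a pair $(X,e)$ of a set $X\subseteq\mathbb N$ and a code $e$ of an oracle machine with one-way output tape which, given access to the oracle $X$, and given any name of any point $z\in D$ as input, writes a name of $f(z)$ on its output tape. (The name carries no further information about $D$.) Let a function $f:D\to\hat{\mathbb C}$ on an open set $D\subseteq\hat{\mathbb C}$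 be called *non-constant meromorphic* if it is meromorphic in the usual sense (with value $\infty$ at its poles; at the point $\infty$ with respect to the coordinate $1/z$), and non-constant; if $D$ is not connected, this means non-constant on every connected component of $D$. Then there is a single machine $M$ with one-way output tape such that the following holds for every open $D\subseteq\hat{\mathbb C}$, every non-constant meromorphic $f:D\to\hat{\mathbb C}$ and every open $U\subseteq D$: the image $f[U]$ is an open subset of $\hat{\mathbb C}$, and whenever $M$ is given any name $(X,e)$ of $f$ and any name of $U$ as input, it writes a name of $f[U]$ on its output tape. -/

import Mathlib

/-! ### Oracle machines -/

/-- Codes of oracle machines: Mathlib's codes `Nat.Partrec.Code` of partial recursive functions with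
one more instruction, `oracle`, which queries the oracle (equivalently, reads a cell of the infinite
input tape). -/
inductive OracleCode : Type
  | zero : OracleCode
  | succ : OracleCode
  | left : OracleCode
  | right : OracleCode
  | oracle : OracleCode
  | pair : OracleCode → OracleCode → OracleCode
  | comp : OracleCode → OracleCode → OracleCode
  | prec : OracleCode → OracleCode → OracleCode
  | rfind' : OracleCode → OracleCode

namespace OracleCode

/-- The partial function computed by a code when the oracle is `A : ℕ → ℕ`. The clauses are those of
`Nat.Partrec.Code.eval`; `oracle` computes `A` itself. -/
def eval (A : ℕ → ℕ) : OracleCode → ℕ →. ℕ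
  | zero => pure 0
  | succ => Nat.succ
  | left => ↑fun n : ℕ => n.unpair.1
  | right => ↑fun n : ℕ => n.unpair.2
  | oracle => A
  | pair cf cg => fun n => Nat.pair <$> eval A cf n <*> eval A cg n
  | comp cf cg => fun n => eval A cg n >>= eval A cf
  | prec cf cg =>
    Nat.unpaired fun a n =>
      n.rec (eval A cf a) fun y IH => do
        let i ← IH
        eval A cg (Nat.pair a (Nat.pair y i))
  | rfind' cf =>
    Nat.unpaired fun a m =>
      (Nat.rfind fun n => (fun k => k = 0) <$> eval A cf (Nat.pair a (n + m))).map (· + m)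

/-- The numbering of codes (each code is given to other machines as this number). -/
def toNat : OracleCode → ℕ
  | zero => 0
  | succ => 1
  | left => 2
  | right => 3
  | oracle => 4
  | pair cf cg => 4 * Nat.pair (toNat cf) (toNat cg) + 5
  | comp cf cg => 4 * Nat.pair (toNat cf) (toNat cg) + 6
  | prec cf cg => 4 * Nat.pair (toNat cf) (toNat cg) + 7
  | rfind' cf => 4 * toNat cf + 8

theorem toNat_injective : Function.Injective toNat := by
  intro c
  induction c with
  | zero | succ | left | right | oracle =>
    intro d h; cases d <;> simp only [toNat] at h <;> first | rfl | omega
  | pair a b iha ihb | comp a b iha ihb | prec a b iha ihb =>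
    intro d h
    cases d <;> simp only [toNat] at h <;> try omega
    rename_i a' b'
    have h' : Nat.pair a.toNat b.toNat = Nat.pair a'.toNat b'.toNat := by omega
    rw [iha (Nat.pair_eq_pair.1 h').1, ihb (Nat.pair_eq_pair.1 h').2]
  | rfind' a iha =>
    intro d h
    cases d <;> simp only [toNat] at h <;> try omega
    rename_i a'
    have h' : a.toNat = a'.toNat := by omega
    rw [iha h']

/-- The codes compute exactly the functions that are recursive in the oracle in Mathlib's sense. -/
theorem exists_eval_eq_iff (A : ℕ → ℕ) (g : ℕ →. ℕ) :
    (∃ c : OracleCode, c.eval A = g) ↔ Nat.RecursiveIn {(A : ℕ →. ℕ)} g := by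
  constructor
  · rintro ⟨c, rfl⟩
    induction c with
    | zero => exact .zero
    | succ => exact .succ
    | left => exact .left
    | right => exact .right
    | oracle => exact .oracle _ rfl
    | pair a b iha ihb => exact .pair iha ihb
    | comp a b iha ihb => exact .comp iha ihb
    | prec a b iha ihb => exact .prec iha ihb
    | rfind' a iha =>
      have h1 : Nat.RecursiveIn {(A : ℕ →. ℕ)}
          (fun p => ((Nat.pair p.unpair.1.unpair.1
            (p.unpair.2 + p.unpair.1.unpair.2) : ℕ) : Part ℕ)) := by
        refine Nat.Partrec.recursiveIn (Nat.Partrec.of_primrec ?_)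
        refine Nat.Primrec.pair (Nat.Primrec.left.comp Nat.Primrec.left) ?_
        exact (Nat.Primrec.add.comp (Nat.Primrec.right.pair
          (Nat.Primrec.right.comp Nat.Primrec.left))).of_eq (by simp [Nat.unpaired])
      have h2 := (iha.comp h1).rfind
      have h3 : Nat.RecursiveIn {(A : ℕ →. ℕ)}
          (fun p => ((p.unpair.1 + p.unpair.2 : ℕ) : Part ℕ)) :=
        Nat.Partrec.recursiveIn (Nat.Partrec.of_primrec Nat.Primrec.add)
      refine (h3.comp (h2.pair .right)).of_eq fun n => ?_
      simp [eval, Nat.unpaired, Seq.seq, Part.map_eq_map, Part.bind_some_eq_map, Part.map_map,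
        Function.comp_def]
      congr 2
      funext k
      congr 1
      exact Part.bind_some _ _
  · intro h
    induction h with
    | zero => exact ⟨zero, rfl⟩
    | succ => exact ⟨succ, rfl⟩
    | left => exact ⟨left, rfl⟩
    | right => exact ⟨right, rfl⟩
    | oracle g hg => exact ⟨oracle, (Set.mem_singleton_iff.1 hg).symm⟩
    | pair _ _ iha ihb =>
      obtain ⟨a, rfl⟩ := iha; obtain ⟨b, rfl⟩ := ihb; exact ⟨pair a b, rfl⟩
    | comp _ _ iha ihb =>
      obtain ⟨a, rfl⟩ := iha; obtain ⟨b, rfl⟩ := ihb; exact ⟨comp a b, rfl⟩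
    | prec _ _ iha ihb =>
      obtain ⟨a, rfl⟩ := iha; obtain ⟨b, rfl⟩ := ihb; exact ⟨prec a b, rfl⟩
    | rfind _ iha =>
      obtain ⟨a, rfl⟩ := iha
      refine ⟨comp (rfind' a) (pair (pair left right) zero), ?_⟩
      funext n
      simp [eval, Nat.unpaired, Seq.seq, pure, PFun.pure, Part.map_id']

/-- With the sequence `A` on its input tape, the machine writes the sequence `q` on its one-way
output tape: the `n`-th output symbol is the value at `n`. -/
def Computes (c : OracleCode) (A q : ℕ → ℕ) : Prop :=
  ∀ n, q n ∈ c.eval A n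

end OracleCode

/-- Two sequences written on one tape: the first in the even cells, the second in the odd cells. -/
def tapeJoin (p q : ℕ → ℕ) (n : ℕ) : ℕ :=
  if n % 2 = 0 then p (n / 2) else q (n / 2)

/-! ### The Riemann sphere and its basic open sets -/

/-- The extended complex plane, with the topology of the one-point compactification. -/
abbrev RiemannSphere : Type := OnePoint ℂ

/-- The open rectangle `(a, b) × (c, d)`, as a subset of the sphere. -/
def openRect (a b c d : ℚ) : Set RiemannSphere :=
  (fun z : ℂ => (z : RiemannSphere)) ''
    {z | (a : ℝ) < z.re ∧ z.re < b ∧ (c : ℝ) < z.im ∧ z.im < d}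

/-- The complement in the sphere of the closed disk of radius `r` about `0`. -/
def diskExterior (r : ℚ) : Set RiemannSphere :=
  ((fun z : ℂ => (z : RiemannSphere)) '' Metric.closedBall 0 (r : ℝ))ᶜ

/-- The basic open sets: rational rectangles, and complements of closed disks about `0` of rational
radius. -/
def IsBasic (S : Set RiemannSphere) : Prop :=
  (∃ a b c d : ℚ, a < b ∧ c < d ∧ S = openRect a b c d) ∨ ∃ r : ℚ, 0 < r ∧ S = diskExterior r

/-- A numbering of the rationals. -/
def ratOfNat (n : ℕ) : ℚ :=
  ((n.unpair.1.unpair.1 : ℚ) - n.unpair.1.unpair.2) / (n.unpair.2 + 1)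

/-- A numbering of the positive rationals. -/
def posRatOfNat (n : ℕ) : ℚ :=
  ((n.unpair.1 : ℚ) + 1) / (n.unpair.2 + 1)

/-- The rectangle with the number `n`; lower left corner and side lengths are coded. -/
def rectOfNat (n : ℕ) : Set RiemannSphere :=
  let a := ratOfNat n.unpair.1.unpair.1
  let c := ratOfNat n.unpair.2.unpair.1
  openRect a (a + posRatOfNat n.unpair.1.unpair.2) c (c + posRatOfNat n.unpair.2.unpair.2)

/-- The numbering of the basic open sets. -/
def basicOfNat (n : ℕ) : Set RiemannSphere :=
  if n % 2 = 0 then rectOfNat (n / 2) else diskExterior (posRatOfNat (n / 2))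

theorem posRatOfNat_pos (n : ℕ) : 0 < posRatOfNat n := by
  unfold posRatOfNat; positivity

theorem exists_posRatOfNat (r : ℚ) (hr : 0 < r) : ∃ n, posRatOfNat n = r := by
  refine ⟨Nat.pair (r.num.toNat - 1) (r.den - 1), ?_⟩
  have h1 : 0 < r.num := Rat.num_pos.2 hr
  have h2 : 0 < r.den := r.den_pos
  have h3 : ((r.num.toNat - 1 : ℕ) : ℚ) + 1 = (r.num : ℚ) := by
    have : ((r.num.toNat - 1 : ℕ) : ℤ) + 1 = r.num := by omega
    exact_mod_cast this
  have h4 : ((r.den - 1 : ℕ) : ℚ) + 1 = (r.den : ℚ) := by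
    have : (r.den - 1 : ℕ) + 1 = r.den := by omega
    exact_mod_cast this
  simp only [posRatOfNat, Nat.unpair_pair]
  rw [h3, h4, Rat.num_div_den]

theorem exists_ratOfNat (r : ℚ) : ∃ n, ratOfNat n = r := by
  refine ⟨Nat.pair (Nat.pair r.num.toNat (-r.num).toNat) (r.den - 1), ?_⟩
  have h2 : 0 < r.den := r.den_pos
  have h3 : ((r.num.toNat : ℕ) : ℚ) - ((-r.num).toNat : ℕ) = (r.num : ℚ) := by
    have : ((r.num.toNat : ℕ) : ℤ) - ((-r.num).toNat : ℕ) = r.num := by omega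
    exact_mod_cast this
  have h4 : ((r.den - 1 : ℕ) : ℚ) + 1 = (r.den : ℚ) := by
    have : (r.den - 1 : ℕ) + 1 = r.den := by omega
    exact_mod_cast this
  simp only [ratOfNat, Nat.unpair_pair]
  rw [h3, h4, Rat.num_div_den]

/-- The numbering reaches exactly the basic open sets. -/
theorem range_basicOfNat : Set.range basicOfNat = {S | IsBasic S} := by
  ext S
  constructor
  · rintro ⟨n, rfl⟩
    unfold basicOfNat
    split_ifs
    · exact Or.inl ⟨_, _, _, _, lt_add_of_pos_right _ (posRatOfNat_pos _),
        lt_add_of_pos_right _ (posRatOfNat_pos _), rfl⟩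
    · exact Or.inr ⟨_, posRatOfNat_pos _, rfl⟩
  · rintro (⟨a, b, c, d, hab, hcd, rfl⟩ | ⟨r, hr, rfl⟩)
    · obtain ⟨i, hi⟩ := exists_ratOfNat a
      obtain ⟨j, hj⟩ := exists_posRatOfNat (b - a) (sub_pos.2 hab)
      obtain ⟨k, hk⟩ := exists_ratOfNat c
      obtain ⟨l, hl⟩ := exists_posRatOfNat (d - c) (sub_pos.2 hcd)
      refine ⟨2 * Nat.pair (Nat.pair i j) (Nat.pair k l), ?_⟩
      simp [basicOfNat, rectOfNat, hi, hj, hk, hl]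
    · obtain ⟨n, hn⟩ := exists_posRatOfNat r hr
      refine ⟨2 * n + 1, ?_⟩
      have h : (2 * n + 1) / 2 = n := by omega
      simp [basicOfNat, h, hn, Nat.add_mod]

/-! ### Names -/

/-- The family of basic open sets listed by a sequence. The entry `0` is a blank, which lists
nothing (so that the empty family can be listed too); the entry `k + 1` lists the basic set with the
number `k`. -/
def listedSets (p : ℕ → ℕ) : Set (Set RiemannSphere) :=
  {S | ∃ n k, p n = k + 1 ∧ basicOfNat k = S}

/-- `p` is a name of the point `z`: a list of all basic open sets that contain `z`. -/
def IsPointName (p : ℕ → ℕ) (z : RiemannSphere) : Prop :=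
  listedSets p = {S | IsBasic S ∧ z ∈ S}

/-- `p` is a name of the open set `U`: a list of all basic open sets whose closures are contained
in `U`. -/
def IsOpenName (p : ℕ → ℕ) (U : Set RiemannSphere) : Prop :=
  listedSets p = {S | IsBasic S ∧ closure S ⊆ U}

/-- The characteristic function of a set of natural numbers. -/
noncomputable def charSeq (X : Set ℕ) : ℕ → ℕ :=
  X.indicator fun _ => 1

/-- The pair `(X, e)` is a name of the function `f` with domain `D`: with the oracle `X`, the machine
with the code `e` turns every name of every point `z` of `D` into a name of `f z`. The input tape
and the oracle are both available to the machine through `tapeJoin`. -/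
def IsFunctionName (X : Set ℕ) (e : OracleCode) (f : RiemannSphere → RiemannSphere)
    (D : Set RiemannSphere) : Prop :=
  ∀ z ∈ D, ∀ p, IsPointName p z →
    ∃ q, e.Computes (tapeJoin p (charSeq X)) q ∧ IsPointName q (f z)

/-- The pair `(X, e)` written as one sequence: first the number of the code `e`, then the
characteristic function of `X`. -/
noncomputable def functionNameSeq (X : Set ℕ) (e : OracleCode) : ℕ → ℕ
  | 0 => e.toNat
  | n + 1 => charSeq X n

/-! ### Meromorphic functions on open subsets of the sphere -/

/-- The complex number underlying a finite point of the sphere (`0` at `∞`). -/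
noncomputable def finitePart : RiemannSphere → ℂ
  | none => 0
  | some z => z

/-- The coordinate at infinity: `w ↦ 1 / w`, with `0 ↦ ∞`. -/
noncomputable def infinityChart (w : ℂ) : RiemannSphere :=
  open Classical in if w = 0 then OnePoint.infty else ((w⁻¹ : ℂ) : RiemannSphere)

/-- `f` is a meromorphic function with domain `D`, an open subset of the sphere: it is meromorphic in
the coordinate `z` at the finite points of `D` and in the coordinate `1 / z` at `∞`, and its values
(`∞` at the poles) are those that make it continuous as a map into the sphere. -/
structure IsMeromorphicOn (f : RiemannSphere → RiemannSphere) (D : Set RiemannSphere) : Prop where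
  isOpen_domain : IsOpen D
  continuousOn : ContinuousOn f D
  meromorphicAt_finite : ∀ z : ℂ, (z : RiemannSphere) ∈ D →
    MeromorphicAt (fun w : ℂ => finitePart (f (w : RiemannSphere))) z
  meromorphicAt_infty : OnePoint.infty ∈ D →
    MeromorphicAt (fun w : ℂ => finitePart (f (infinityChart w))) 0

/-- `f` is non-constant on `D`, where for a disconnected `D` this means: on every connected component
of `D`. -/
def IsNonconstantOn (f : RiemannSphere → RiemannSphere) (D : Set RiemannSphere) : Prop :=
  ∀ x ∈ D, ∃ y ∈ connectedComponentIn D x, f y ≠ f x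

/-! ### Inclusion and disjointness of basic sets -/

/-! The inclusion of the closure of a basic set in `f '' U` has finite certificates that can be
searched for with the input tape as oracle; the machine lists the basic sets for which a certificate
turns up. Three kinds of certificate are nested.

`MapsBasic`: a finite input for the machine `e`, all of whose listed sets contain a basic set `c`,
makes `e` output `v`. Every point of `c` in `D` has a name that begins with this input, so `f` sends
it into `v` (`MapsBasic.apply_mem`). Conversely, a halting run reads only finitely many cells, so it
serves all small basic sets near the given point (`IsFunctionName.exists_nhds_mapsBasic`).

`ImageContainsBasic`: a set `r` listed in the name of `U` has an image that meets `v`, while the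
image of its boundary misses `v`. The trace of `f '' r` on `v` is then open by the open mapping
theorem and relatively closed because `closure r` is compact. Basic sets are connected, so `v ⊆ f ''
r`. Neither winding numbers nor moduli of continuity are needed. These sets exhaust the image
because preimages are isolated: around `z ∈ U` there is an `r` whose boundary avoids the fibre of `f
z`, and a small `v` around `f z` avoids the compact image of that boundary.

`ImageCoversBasic`: compactness reduces the inclusion of a closure to finitely many cells of a grid,
each contained in some certified `v`.

Two ingredients are independent of each other. On the computability side, relations between basic
sets are primitive recursive, a run with a finite piece of oracle is an ordinary partial recursive
computation (`OracleCode.simulateNat_toNat`), and relations of the form `OracleSemidecidable` are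
closed under the quantifiers used here and are enumerated by one machine
(`OracleSemidecidable.exists_machine`). On the analytic side, openness and isolated fibres come from
the local theory in charts together with the identity theorem
(`IsMeromorphicOn.not_eventually_constant`). -/

theorem coe_mem_openRect {a b c d : ℚ} {z : ℂ} : (z : RiemannSphere) ∈ openRect a b c d ↔
    (a : ℝ) < z.re ∧ z.re < b ∧ (c : ℝ) < z.im ∧ z.im < d := by
  simp [openRect]

theorem infty_notMem_openRect {a b c d : ℚ} :
    (OnePoint.infty : RiemannSphere) ∉ openRect a b c d := by
  simp [openRect]

theorem coe_mem_diskExterior {r : ℚ} {z : ℂ} :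
    (z : RiemannSphere) ∈ diskExterior r ↔ (r : ℝ) < ‖z‖ := by
  simp [diskExterior]

theorem infty_mem_diskExterior {r : ℚ} : (OnePoint.infty : RiemannSphere) ∈ diskExterior r := by
  simp [diskExterior]

theorem lt_norm_iff_sq_lt {r : ℝ} (hr : 0 ≤ r) (z : ℂ) :
    r < ‖z‖ ↔ r * r < z.re * z.re + z.im * z.im := by
  rw [← Complex.normSq_apply, Complex.normSq_eq_norm_sq, ← pow_two, sq_lt_sq₀ hr (norm_nonneg z)]

/-- A closed set that contains an open rectangle contains the closed rectangle. -/
theorem mem_of_forall_mem_rect {S : Set ℂ} (hS : IsClosed S) {a b c d : ℝ} (hab : a < b)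
    (hcd : c < d) (h : ∀ z : ℂ, a < z.re → z.re < b → c < z.im → z.im < d → z ∈ S)
    {x y : ℝ} (hx : x ∈ Set.Icc a b) (hy : y ∈ Set.Icc c d) : (⟨x, y⟩ : ℂ) ∈ S := by
  have hsub : Set.Ioo a b ×ℂ Set.Ioo c d ⊆ S := fun z hz =>
    h z hz.1.1 hz.1.2 hz.2.1 hz.2.2
  refine closure_minimal hsub hS ?_
  rw [Complex.closure_reProdIm, closure_Ioo hab.ne, closure_Ioo hcd.ne]
  exact ⟨hx, hy⟩

theorem openRect_subset_openRect_iff {a b c d a' b' c' d' : ℚ} (hab : a < b) (hcd : c < d) :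
    openRect a b c d ⊆ openRect a' b' c' d' ↔ a' ≤ a ∧ b ≤ b' ∧ c' ≤ c ∧ d ≤ d' := by
  have hab' : (a : ℝ) < b := by exact_mod_cast hab
  have hcd' : (c : ℝ) < d := by exact_mod_cast hcd
  constructor
  · intro h
    have hcl : IsClosed {z : ℂ | (a' : ℝ) ≤ z.re ∧ z.re ≤ b' ∧ (c' : ℝ) ≤ z.im ∧ z.im ≤ d'} :=
      (isClosed_le continuous_const Complex.continuous_re).inter <|
      (isClosed_le Complex.continuous_re continuous_const).inter <|
      (isClosed_le continuous_const Complex.continuous_im).inter <|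
      isClosed_le Complex.continuous_im continuous_const
    have key := fun x y => mem_of_forall_mem_rect hcl hab' hcd' (fun z h1 h2 h3 h4 => by
      have := coe_mem_openRect.1 (h (coe_mem_openRect.2 ⟨h1, h2, h3, h4⟩))
      exact ⟨this.1.le, this.2.1.le, this.2.2.1.le, this.2.2.2.le⟩) (x := x) (y := y)
    -- Two opposite corners of the closed rectangle already carry all four inequalities.
    have h1 := key a c ⟨le_rfl, hab'.le⟩ ⟨le_rfl, hcd'.le⟩
    have h2 := key b d ⟨hab'.le, le_rfl⟩ ⟨hcd'.le, le_rfl⟩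
    simp only [Set.mem_ofPred_eq] at h1 h2
    exact ⟨by exact_mod_cast h1.1, by exact_mod_cast h2.2.1, by exact_mod_cast h1.2.2.1,
      by exact_mod_cast h2.2.2.2⟩
  · rintro ⟨h1, h2, h3, h4⟩ _ ⟨z, ⟨g1, g2, g3, g4⟩, rfl⟩
    refine coe_mem_openRect.2 ⟨lt_of_le_of_lt ?_ g1, lt_of_lt_of_le g2 ?_, lt_of_le_of_lt ?_ g3,
      lt_of_lt_of_le g4 ?_⟩ <;> assumption_mod_cast

/-- The minimum of `x * x` on the interval `[a, b]`. -/
def minSq (a b : ℚ) : ℚ :=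
  if 0 ≤ a then a * a else if b ≤ 0 then b * b else 0

theorem exists_mul_self_eq_minSq {a b : ℚ} (hab : a < b) :
    ∃ x : ℚ, a ≤ x ∧ x ≤ b ∧ x * x = minSq a b := by
  unfold minSq
  split_ifs with h1 h2
  · exact ⟨a, le_rfl, hab.le, rfl⟩
  · exact ⟨b, hab.le, le_rfl, rfl⟩
  · exact ⟨0, by linarith, by linarith, by norm_num⟩

/-- The minimum over the closed interval is attained in the open one only at `x = 0`, hence the
second alternative. -/
theorem minSq_lt_mul_self {a b : ℚ} {x : ℝ} (ha : a < x) (hb : x < b) :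
    (minSq a b : ℝ) < x * x ∨ minSq a b = 0 := by
  unfold minSq
  split_ifs with h1 h2
  · left
    have : (0 : ℝ) ≤ a := by exact_mod_cast h1
    push_cast
    nlinarith
  · left
    have : (b : ℝ) ≤ 0 := by exact_mod_cast h2
    push_cast
    nlinarith
  · exact Or.inr rfl

theorem openRect_subset_diskExterior_iff {a b c d r : ℚ} (hab : a < b) (hcd : c < d)
    (hr : 0 < r) : openRect a b c d ⊆ diskExterior r ↔ r * r ≤ minSq a b + minSq c d := by
  have hab' : (a : ℝ) < b := by exact_mod_cast hab
  have hcd' : (c : ℝ) < d := by exact_mod_cast hcd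
  have hr' : (0 : ℝ) < r := by exact_mod_cast hr
  constructor
  · intro h
    obtain ⟨x, hx1, hx2, hx⟩ := exists_mul_self_eq_minSq hab
    obtain ⟨y, hy1, hy2, hy⟩ := exists_mul_self_eq_minSq hcd
    have hcl : IsClosed {z : ℂ | (r : ℝ) * r ≤ z.re * z.re + z.im * z.im} :=
      isClosed_le continuous_const (by fun_prop)
    have := mem_of_forall_mem_rect hcl hab' hcd' (fun z h1 h2 h3 h4 => by
      have := coe_mem_diskExterior.1 (h (coe_mem_openRect.2 ⟨h1, h2, h3, h4⟩))
      exact ((lt_norm_iff_sq_lt hr'.le z).1 this).le) (x := x) (y := y)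
      ⟨by exact_mod_cast hx1, by exact_mod_cast hx2⟩ ⟨by exact_mod_cast hy1, by exact_mod_cast hy2⟩
    rw [← hx, ← hy]
    simp only [Set.mem_ofPred_eq] at this
    exact_mod_cast this
  · rintro h _ ⟨z, ⟨g1, g2, g3, g4⟩, rfl⟩
    rw [coe_mem_diskExterior, lt_norm_iff_sq_lt hr'.le]
    have h' : (r : ℝ) * r ≤ minSq a b + minSq c d := by exact_mod_cast h
    have hrr : (0 : ℝ) < r * r := mul_pos hr' hr'
    have h1 := mul_self_nonneg z.re
    have h2 := mul_self_nonneg z.im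
    -- Since `0 < r`, the two minima cannot both vanish, so some coordinate supplies the strict
    -- inequality.
    rcases minSq_lt_mul_self g1 g2 with hx | hx <;> rcases minSq_lt_mul_self g3 g4 with hy | hy
    · linarith
    · rw [hy, Rat.cast_zero] at h'; linarith
    · rw [hx, Rat.cast_zero] at h'; linarith
    · rw [hx, hy, Rat.cast_zero] at h'; linarith

theorem not_diskExterior_subset_openRect {a b c d r : ℚ} :
    ¬ diskExterior r ⊆ openRect a b c d :=
  fun h => infty_notMem_openRect (h infty_mem_diskExterior)

theorem diskExterior_subset_diskExterior_iff {r r' : ℚ} (hr : 0 < r) :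
    diskExterior r ⊆ diskExterior r' ↔ r' ≤ r := by
  constructor
  · intro h
    by_contra! hlt
    have hr' : (r : ℝ) < r' := by exact_mod_cast hlt
    have h0 : (0 : ℝ) < r := by exact_mod_cast hr
    have hn : ‖((r' : ℝ) : ℂ)‖ = r' := by
      rw [Complex.norm_real, Real.norm_of_nonneg (by linarith)]
    have := coe_mem_diskExterior.1 (h ((coe_mem_diskExterior (z := ((r' : ℝ) : ℂ))).2
      (by rwa [hn])))
    rw [hn] at this
    exact lt_irrefl _ this
  · intro h x hx
    induction x using OnePoint.rec with
    | infty => exact infty_mem_diskExterior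
    | coe z =>
      rw [coe_mem_diskExterior] at hx ⊢
      exact lt_of_le_of_lt (by exact_mod_cast h) hx

theorem disjoint_openRect_openRect_iff {a b c d a' b' c' d' : ℚ} (hab : a < b) (hcd : c < d)
    (hab' : a' < b') (hcd' : c' < d') : Disjoint (openRect a b c d) (openRect a' b' c' d') ↔
      b ≤ a' ∨ b' ≤ a ∨ d ≤ c' ∨ d' ≤ c := by
  rw [Set.disjoint_left]
  constructor
  · intro h
    by_contra! hlt
    obtain ⟨h1, h2, h3, h4⟩ := hlt
    obtain ⟨x, hx1, hx2⟩ := exists_between (max_lt (lt_min hab h2) (lt_min h1 hab'))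
    obtain ⟨y, hy1, hy2⟩ := exists_between (max_lt (lt_min hcd h4) (lt_min h3 hcd'))
    simp only [max_lt_iff, lt_min_iff] at hx1 hx2 hy1 hy2
    refine h (a := ((⟨(x : ℝ), (y : ℝ)⟩ : ℂ) : RiemannSphere)) (coe_mem_openRect.2 ?_)
      (coe_mem_openRect.2 ?_)
    · simp only [Rat.cast_lt]
      exact ⟨hx1.1, hx2.1, hy1.1, hy2.1⟩
    · simp only [Rat.cast_lt]
      exact ⟨hx1.2, hx2.2, hy1.2, hy2.2⟩
  · rintro h _ ⟨z, ⟨g1, g2, g3, g4⟩, rfl⟩ hz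
    obtain ⟨k1, k2, k3, k4⟩ := coe_mem_openRect.1 hz
    rcases h with h | h | h | h
    · have : (b : ℝ) ≤ a' := by exact_mod_cast h
      linarith
    · have : (b' : ℝ) ≤ a := by exact_mod_cast h
      linarith
    · have : (d : ℝ) ≤ c' := by exact_mod_cast h
      linarith
    · have : (d' : ℝ) ≤ c := by exact_mod_cast h
      linarith

/-- By convexity the square is largest at an end of the interval. -/
theorem mul_self_le_or_of_mem_Ioo {a b x : ℝ} (ha : a < x) (hb : x < b) :
    x * x ≤ a * a ∨ x * x ≤ b * b := by
  rcases le_total 0 x with h | h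
  · right; nlinarith
  · left; nlinarith

/-- Disjointness means that the rectangle lies in the closed disk, and by convexity this is decided
at the four corners. -/
theorem disjoint_openRect_diskExterior_iff {a b c d r : ℚ} (hab : a < b) (hcd : c < d)
    (hr : 0 < r) : Disjoint (openRect a b c d) (diskExterior r) ↔
      (a * a + c * c ≤ r * r ∧ a * a + d * d ≤ r * r) ∧
        b * b + c * c ≤ r * r ∧ b * b + d * d ≤ r * r := by
  have hab' : (a : ℝ) < b := by exact_mod_cast hab
  have hcd' : (c : ℝ) < d := by exact_mod_cast hcd
  have hr' : (0 : ℝ) < r := by exact_mod_cast hr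
  rw [Set.disjoint_left]
  constructor
  · intro h
    have hcl : IsClosed {z : ℂ | z.re * z.re + z.im * z.im ≤ (r : ℝ) * r} :=
      isClosed_le (by fun_prop) continuous_const
    have key := fun x y => mem_of_forall_mem_rect hcl hab' hcd' (fun z h1 h2 h3 h4 => by
      have := mt coe_mem_diskExterior.2 (h (coe_mem_openRect.2 ⟨h1, h2, h3, h4⟩))
      rw [lt_norm_iff_sq_lt hr'.le] at this
      exact not_lt.1 this) (x := x) (y := y)
    simp only [Set.mem_ofPred_eq] at key
    have ha : (a : ℝ) ∈ Set.Icc (a : ℝ) b := ⟨le_rfl, hab'.le⟩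
    have hb : (b : ℝ) ∈ Set.Icc (a : ℝ) b := ⟨hab'.le, le_rfl⟩
    have hc : (c : ℝ) ∈ Set.Icc (c : ℝ) d := ⟨le_rfl, hcd'.le⟩
    have hd : (d : ℝ) ∈ Set.Icc (c : ℝ) d := ⟨hcd'.le, le_rfl⟩
    exact ⟨⟨by exact_mod_cast key a c ha hc, by exact_mod_cast key a d ha hd⟩,
      by exact_mod_cast key b c hb hc, by exact_mod_cast key b d hb hd⟩
  · rintro ⟨⟨h1, h2⟩, h3, h4⟩ _ ⟨z, ⟨g1, g2, g3, g4⟩, rfl⟩ hz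
    rw [coe_mem_diskExterior, lt_norm_iff_sq_lt hr'.le] at hz
    have h1' : (a : ℝ) * a + c * c ≤ r * r := by exact_mod_cast h1
    have h2' : (a : ℝ) * a + d * d ≤ r * r := by exact_mod_cast h2
    have h3' : (b : ℝ) * b + c * c ≤ r * r := by exact_mod_cast h3
    have h4' : (b : ℝ) * b + d * d ≤ r * r := by exact_mod_cast h4
    rcases mul_self_le_or_of_mem_Ioo g1 g2 with hx | hx <;>
      rcases mul_self_le_or_of_mem_Ioo g3 g4 with hy | hy <;> linarith

theorem not_disjoint_diskExterior_diskExterior {r r' : ℚ} :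
    ¬ Disjoint (diskExterior r) (diskExterior r') :=
  fun h => Set.disjoint_left.1 h infty_mem_diskExterior infty_mem_diskExterior

/-! ### Primitive recursive functions into the rationals -/

/-- A rational-valued function whose value is given by primitive recursive numerators and
denominators. -/
def PrimrecRat {α : Type*} [Primcodable α] (f : α → ℚ) : Prop :=
  ∃ p q d : α → ℕ, Primrec p ∧ Primrec q ∧ Primrec d ∧
    ∀ a, f a = ((p a : ℚ) - q a) / (d a + 1)

namespace PrimrecRat

variable {α : Type*} [Primcodable α] {f g : α → ℚ}

theorem ratOfNat {k : α → ℕ} (hk : Primrec k) : PrimrecRat fun a => ratOfNat (k a) :=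
  ⟨fun a => (k a).unpair.1.unpair.1, fun a => (k a).unpair.1.unpair.2, fun a => (k a).unpair.2,
    Primrec.fst.comp (Primrec.unpair.comp (Primrec.fst.comp (Primrec.unpair.comp hk))),
    Primrec.snd.comp (Primrec.unpair.comp (Primrec.fst.comp (Primrec.unpair.comp hk))),
    Primrec.snd.comp (Primrec.unpair.comp hk), fun _ => rfl⟩

theorem posRatOfNat {k : α → ℕ} (hk : Primrec k) : PrimrecRat fun a => posRatOfNat (k a) :=
  ⟨fun a => (k a).unpair.1 + 1, fun _ => 0, fun a => (k a).unpair.2,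
    Primrec.succ.comp (Primrec.fst.comp (Primrec.unpair.comp hk)), Primrec.const 0,
    Primrec.snd.comp (Primrec.unpair.comp hk), fun a => by simp [_root_.posRatOfNat]⟩

theorem zero : PrimrecRat fun _ : α => 0 :=
  ⟨fun _ => 0, fun _ => 0, fun _ => 0, Primrec.const 0, Primrec.const 0, Primrec.const 0,
    fun _ => by simp⟩

theorem add (hf : PrimrecRat f) (hg : PrimrecRat g) : PrimrecRat fun a => f a + g a := by
  obtain ⟨p, q, d, hp, hq, hd, h⟩ := hf
  obtain ⟨p', q', d', hp', hq', hd', h'⟩ := hg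
  have hs := Primrec.succ.comp hd
  have hs' := Primrec.succ.comp hd'
  -- Denominators are stored minus one, so the product denominator is stored as `(d + 1) * (d' + 1)
  -- - 1`.
  refine ⟨fun a => p a * (d' a + 1) + p' a * (d a + 1),
    fun a => q a * (d' a + 1) + q' a * (d a + 1), fun a => d a * d' a + d a + d' a,
    Primrec.nat_add.comp (Primrec.nat_mul.comp hp hs') (Primrec.nat_mul.comp hp' hs),
    Primrec.nat_add.comp (Primrec.nat_mul.comp hq hs') (Primrec.nat_mul.comp hq' hs),
    Primrec.nat_add.comp (Primrec.nat_add.comp (Primrec.nat_mul.comp hd hd') hd) hd',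
    fun a => ?_⟩
  have e : ((d a * d' a + d a + d' a : ℕ) : ℚ) + 1 = (d a + 1) * (d' a + 1) := by push_cast; ring
  simp only [h, h', e]
  rw [ div_add_div _ _ (by positivity) (by positivity)]
  push_cast
  ring

theorem mul (hf : PrimrecRat f) (hg : PrimrecRat g) : PrimrecRat fun a => f a * g a := by
  obtain ⟨p, q, d, hp, hq, hd, h⟩ := hf
  obtain ⟨p', q', d', hp', hq', hd', h'⟩ := hg
  refine ⟨fun a => p a * p' a + q a * q' a, fun a => p a * q' a + q a * p' a,
    fun a => d a * d' a + d a + d' a,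
    Primrec.nat_add.comp (Primrec.nat_mul.comp hp hp') (Primrec.nat_mul.comp hq hq'),
    Primrec.nat_add.comp (Primrec.nat_mul.comp hp hq') (Primrec.nat_mul.comp hq hp'),
    Primrec.nat_add.comp (Primrec.nat_add.comp (Primrec.nat_mul.comp hd hd') hd) hd',
    fun a => ?_⟩
  have e : ((d a * d' a + d a + d' a : ℕ) : ℚ) + 1 = (d a + 1) * (d' a + 1) := by push_cast; ring
  simp only [h, h', e]
  rw [ div_mul_div_comm]
  push_cast
  ring

/-- Cross-multiplying and moving the subtracted parts to the other side leaves a comparison of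
natural numbers, with no truncated subtraction. -/
theorem le (hf : PrimrecRat f) (hg : PrimrecRat g) : PrimrecPred fun a => f a ≤ g a := by
  obtain ⟨p, q, d, hp, hq, hd, h⟩ := hf
  obtain ⟨p', q', d', hp', hq', hd', h'⟩ := hg
  have hs := Primrec.succ.comp hd
  have hs' := Primrec.succ.comp hd'
  refine (Primrec.nat_le.comp
    (Primrec.nat_add.comp (Primrec.nat_mul.comp hp hs') (Primrec.nat_mul.comp hq' hs))
    (Primrec.nat_add.comp (Primrec.nat_mul.comp hp' hs)
      (Primrec.nat_mul.comp hq hs'))).of_eq fun a => ?_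
  rw [h, h', div_le_div_iff₀ (by positivity) (by positivity), ← Nat.cast_le (α := ℚ)]
  push_cast
  constructor <;> intro H <;> linarith

theorem ite {c : α → Prop} [DecidablePred c] (hc : PrimrecPred c) (hf : PrimrecRat f)
    (hg : PrimrecRat g) : PrimrecRat fun a => if c a then f a else g a := by
  obtain ⟨p, q, d, hp, hq, hd, h⟩ := hf
  obtain ⟨p', q', d', hp', hq', hd', h'⟩ := hg
  refine ⟨_, _, _, Primrec.ite hc hp hp', Primrec.ite hc hq hq', Primrec.ite hc hd hd',
    fun a => ?_⟩
  by_cases hca : c a <;> simp [hca, h, h']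

theorem minSq (hf : PrimrecRat f) (hg : PrimrecRat g) : PrimrecRat fun a => minSq (f a) (g a) :=
  ite (le zero hf) (mul hf hf) (ite (le hg zero) (mul hg hg) zero)

end PrimrecRat

/-! ### The basic relations between basic sets are primitive recursive -/

/-- The left side of the rectangle with the number `n / 2`. -/
def rectLeft (n : ℕ) : ℚ := ratOfNat (n / 2).unpair.1.unpair.1

/-- The right side of the rectangle with the number `n / 2`. -/
def rectRight (n : ℕ) : ℚ := rectLeft n + posRatOfNat (n / 2).unpair.1.unpair.2

/-- The lower side of the rectangle with the number `n / 2`. -/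
def rectLower (n : ℕ) : ℚ := ratOfNat (n / 2).unpair.2.unpair.1

/-- The upper side of the rectangle with the number `n / 2`. -/
def rectUpper (n : ℕ) : ℚ := rectLower n + posRatOfNat (n / 2).unpair.2.unpair.2

/-- The radius of the disk with the number `n / 2`. -/
def diskRadius (n : ℕ) : ℚ := posRatOfNat (n / 2)

theorem basicOfNat_of_even {n : ℕ} (h : n % 2 = 0) :
    basicOfNat n = openRect (rectLeft n) (rectRight n) (rectLower n) (rectUpper n) := by
  simp only [basicOfNat, h, if_true]
  rfl

theorem basicOfNat_of_odd {n : ℕ} (h : ¬ n % 2 = 0) :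
    basicOfNat n = diskExterior (diskRadius n) := by
  simp only [basicOfNat, h, if_false]
  rfl

theorem rectLeft_lt_rectRight (n : ℕ) : rectLeft n < rectRight n :=
  lt_add_of_pos_right _ (posRatOfNat_pos _)

theorem rectLower_lt_rectUpper (n : ℕ) : rectLower n < rectUpper n :=
  lt_add_of_pos_right _ (posRatOfNat_pos _)

theorem diskRadius_pos (n : ℕ) : 0 < diskRadius n :=
  posRatOfNat_pos _

section

variable {α : Type*} [Primcodable α] {k : α → ℕ}

theorem primrecRat_rectLeft (hk : Primrec k) : PrimrecRat fun a => rectLeft (k a) :=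
  PrimrecRat.ratOfNat (Primrec.fst.comp (Primrec.unpair.comp (Primrec.fst.comp
    (Primrec.unpair.comp (Primrec.nat_div.comp hk (Primrec.const 2))))))

theorem primrecRat_rectRight (hk : Primrec k) : PrimrecRat fun a => rectRight (k a) :=
  (primrecRat_rectLeft hk).add <| PrimrecRat.posRatOfNat (Primrec.snd.comp (Primrec.unpair.comp
    (Primrec.fst.comp (Primrec.unpair.comp (Primrec.nat_div.comp hk (Primrec.const 2))))))

theorem primrecRat_rectLower (hk : Primrec k) : PrimrecRat fun a => rectLower (k a) :=
  PrimrecRat.ratOfNat (Primrec.fst.comp (Primrec.unpair.comp (Primrec.snd.comp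
    (Primrec.unpair.comp (Primrec.nat_div.comp hk (Primrec.const 2))))))

theorem primrecRat_rectUpper (hk : Primrec k) : PrimrecRat fun a => rectUpper (k a) :=
  (primrecRat_rectLower hk).add <| PrimrecRat.posRatOfNat (Primrec.snd.comp (Primrec.unpair.comp
    (Primrec.snd.comp (Primrec.unpair.comp (Primrec.nat_div.comp hk (Primrec.const 2))))))

theorem primrecRat_diskRadius (hk : Primrec k) : PrimrecRat fun a => diskRadius (k a) :=
  PrimrecRat.posRatOfNat (Primrec.nat_div.comp hk (Primrec.const 2))

theorem primrecPred_even (hk : Primrec k) : PrimrecPred fun a => k a % 2 = 0 :=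
  Primrec.eq.comp (Primrec.nat_mod.comp hk (Primrec.const 2)) (Primrec.const 0)

end

/-- Parity gives the two shapes, and each combination reduces to rational inequalities. The
exterior-in-rectangle case contributes no clause, because `∞` rules it out. -/
theorem primrecPred_basicOfNat_subset :
    PrimrecPred fun x : ℕ × ℕ => basicOfNat x.1 ⊆ basicOfNat x.2 := by
  have hu : Primrec fun x : ℕ × ℕ => x.1 := Primrec.fst
  have hv : Primrec fun x : ℕ × ℕ => x.2 := Primrec.snd
  refine (((primrecPred_even hu).and (primrecPred_even hv)).and
    (((primrecRat_rectLeft hv).le (primrecRat_rectLeft hu)).and <|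
      ((primrecRat_rectRight hu).le (primrecRat_rectRight hv)).and <|
      ((primrecRat_rectLower hv).le (primrecRat_rectLower hu)).and
        ((primrecRat_rectUpper hu).le (primrecRat_rectUpper hv)))
    |>.or <| (((primrecPred_even hu).and (primrecPred_even hv).not).and
    (((primrecRat_diskRadius hv).mul (primrecRat_diskRadius hv)).le
      (((primrecRat_rectLeft hu).minSq (primrecRat_rectRight hu)).add
        ((primrecRat_rectLower hu).minSq (primrecRat_rectUpper hu))))).or <|
    (((primrecPred_even hu).not.and (primrecPred_even hv).not).and
      ((primrecRat_diskRadius hv).le (primrecRat_diskRadius hu)))).of_eq fun ⟨u, v⟩ => ?_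
  dsimp only
  by_cases h1 : u % 2 = 0 <;> by_cases h2 : v % 2 = 0
  · rw [basicOfNat_of_even h1, basicOfNat_of_even h2,
      openRect_subset_openRect_iff (rectLeft_lt_rectRight u) (rectLower_lt_rectUpper u)]
    simp [h1, h2]
  · rw [basicOfNat_of_even h1, basicOfNat_of_odd h2, openRect_subset_diskExterior_iff
      (rectLeft_lt_rectRight u) (rectLower_lt_rectUpper u) (diskRadius_pos v)]
    simp [h1, h2]
  · rw [basicOfNat_of_odd h1, basicOfNat_of_even h2]
    simp [h1, h2, not_diskExterior_subset_openRect]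
  · rw [basicOfNat_of_odd h1, basicOfNat_of_odd h2,
      diskExterior_subset_diskExterior_iff (diskRadius_pos u)]
    simp [h1, h2]

/-- The side and radius functions are defined for numbers of either parity, so no parity assumption
is needed and both mixed cases of disjointness can use this, one of them with the arguments swapped.
-/
theorem primrecPred_rect_inside_disk : PrimrecPred fun x : ℕ × ℕ =>
    Disjoint (openRect (rectLeft x.1) (rectRight x.1) (rectLower x.1) (rectUpper x.1))
      (diskExterior (diskRadius x.2)) := by
  have ha : PrimrecRat fun x : ℕ × ℕ => rectLeft x.1 := primrecRat_rectLeft Primrec.fst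
  have hb : PrimrecRat fun x : ℕ × ℕ => rectRight x.1 := primrecRat_rectRight Primrec.fst
  have hc : PrimrecRat fun x : ℕ × ℕ => rectLower x.1 := primrecRat_rectLower Primrec.fst
  have hd : PrimrecRat fun x : ℕ × ℕ => rectUpper x.1 := primrecRat_rectUpper Primrec.fst
  have hr : PrimrecRat fun x : ℕ × ℕ => diskRadius x.2 := primrecRat_diskRadius Primrec.snd
  exact ((((ha.mul ha).add (hc.mul hc)).le (hr.mul hr)).and
    (((ha.mul ha).add (hd.mul hd)).le (hr.mul hr)) |>.and <|
    (((hb.mul hb).add (hc.mul hc)).le (hr.mul hr)).and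
    (((hb.mul hb).add (hd.mul hd)).le (hr.mul hr))).of_eq fun x =>
      (disjoint_openRect_diskExterior_iff (rectLeft_lt_rectRight _) (rectLower_lt_rectUpper _)
        (diskRadius_pos _)).symm

theorem primrecPred_basicOfNat_disjoint :
    PrimrecPred fun x : ℕ × ℕ => Disjoint (basicOfNat x.1) (basicOfNat x.2) := by
  have hu : Primrec fun x : ℕ × ℕ => x.1 := Primrec.fst
  have hv : Primrec fun x : ℕ × ℕ => x.2 := Primrec.snd
  refine (((primrecPred_even hu).and (primrecPred_even hv)).and
    (((primrecRat_rectRight hu).le (primrecRat_rectLeft hv)).or <|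
      ((primrecRat_rectRight hv).le (primrecRat_rectLeft hu)).or <|
      ((primrecRat_rectUpper hu).le (primrecRat_rectLower hv)).or
        ((primrecRat_rectUpper hv).le (primrecRat_rectLower hu)))
    |>.or <| (((primrecPred_even hu).and (primrecPred_even hv).not).and
      primrecPred_rect_inside_disk).or <|
    (((primrecPred_even hu).not.and (primrecPred_even hv)).and
      (primrecPred_rect_inside_disk.comp (Primrec.pair hv hu)))).of_eq fun ⟨u, v⟩ => ?_
  dsimp only
  by_cases h1 : u % 2 = 0 <;> by_cases h2 : v % 2 = 0
  · rw [basicOfNat_of_even h1, basicOfNat_of_even h2, disjoint_openRect_openRect_iff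
      (rectLeft_lt_rectRight u) (rectLower_lt_rectUpper u) (rectLeft_lt_rectRight v)
      (rectLower_lt_rectUpper v)]
    simp [h1, h2]
  · rw [basicOfNat_of_even h1, basicOfNat_of_odd h2]
    simp [h1, h2]
  · rw [basicOfNat_of_odd h1, basicOfNat_of_even h2]
    simp [h1, h2, disjoint_comm]
  · rw [basicOfNat_of_odd h1, basicOfNat_of_odd h2]
    simp [h1, h2, not_disjoint_diskExterior_diskExterior]

/-! ### Simulation of oracle machines -/

open Nat.Partrec (Code)
open Filter

/-- The first `m` symbols of the sequence `A`. -/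
def oraclePrefix (A : ℕ → ℕ) (m : ℕ) : List ℕ :=
  (List.range m).map A

theorem length_oraclePrefix (A : ℕ → ℕ) (m : ℕ) : (oraclePrefix A m).length = m := by
  simp [oraclePrefix]

theorem oraclePrefix_getElem?_eq_some {A : ℕ → ℕ} {m i v : ℕ} :
    (oraclePrefix A m)[i]? = some v ↔ i < m ∧ A i = v := by
  by_cases h : i < m
  · simp [oraclePrefix, h]
  · simp [oraclePrefix, h]

theorem exists_lookupCode : ∃ c : Code, ∀ (l : List ℕ) (n : ℕ),
    c.eval (Nat.pair (Encodable.encode l) n) = (l[n]? : Part ℕ) := by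
  have h : Primrec fun m : ℕ =>
      (Denumerable.ofNat (List ℕ) m.unpair.1)[m.unpair.2]? :=
    Primrec.list_getElem?.comp ((Primrec.ofNat (List ℕ)).comp (Primrec.fst.comp Primrec.unpair))
      (Primrec.snd.comp Primrec.unpair)
  obtain ⟨c, hc⟩ := Code.exists_code.1 (Partrec.nat_iff.1 h.to_comp.ofOption)
  refine ⟨c, fun l n => ?_⟩
  rw [hc]
  simp

/-- A code that looks up an entry of a finite list and diverges outside of it. -/
noncomputable def lookupCode : Code := exists_lookupCode.choose

theorem eval_lookupCode (l : List ℕ) (n : ℕ) :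
    lookupCode.eval (Nat.pair (Encodable.encode l) n) = (l[n]? : Part ℕ) :=
  exists_lookupCode.choose_spec l n

theorem some_bind_pfun (f : ℕ →. ℕ) (n : ℕ) : (Part.some n >>= f) = f n :=
  Part.bind_some n f

theorem mem_bind_pfun {p : Part ℕ} {f : ℕ →. ℕ} {x : ℕ} :
    x ∈ (p >>= f) ↔ ∃ u ∈ p, x ∈ f u :=
  Part.mem_bind_iff

theorem mem_map_rfind {g : ℕ → Part ℕ} {m x : ℕ} :
    x ∈ (Nat.rfind fun k => (fun j => decide (j = 0)) <$> g k).map (· + m) ↔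
      ∃ k, 0 ∈ g k ∧ (∀ i < k, ∃ j ∈ g i, j ≠ 0) ∧ k + m = x := by
  rw [Part.mem_map_iff]
  refine exists_congr fun k => ?_
  rw [← and_assoc]
  refine and_congr_left fun _ => ?_
  refine Nat.mem_rfind.trans (and_congr ?_ (forall₂_congr fun i _ => ?_))
  · simp [Part.map_eq_map]
  · simp [Part.map_eq_map]

/-- Rearranges `((l, x), y)` to `(l, (x, y))`. -/
def assocCode : Code :=
  .pair (.comp .left .left) (.pair (.comp .right .left) .right)

/-- Rearranges `(l, (x, y))` to `((l, x), y)`. -/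
def unassocCode : Code :=
  .pair (.pair .left (.comp .left .right)) (.comp .right .right)

theorem eval_assocCode (l x y : ℕ) :
    assocCode.eval (Nat.pair (Nat.pair l x) y) = Part.some (Nat.pair l (Nat.pair x y)) := by
  simp [assocCode, Code.eval, Seq.seq, some_bind_pfun]

theorem eval_unassocCode (l x y : ℕ) :
    unassocCode.eval (Nat.pair l (Nat.pair x y)) = Part.some (Nat.pair (Nat.pair l x) y) := by
  simp [unassocCode, Code.eval, Seq.seq, some_bind_pfun]

namespace OracleCode

/-- The oracle-free code that, on input `(l, n)`, runs the oracle machine on `n` with the finite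
list `l` in the place of the oracle. -/
noncomputable def simulate : OracleCode → Code
  | zero => .zero
  | succ => .comp .succ .right
  | left => .comp .left .right
  | right => .comp .right .right
  | oracle => lookupCode
  | pair a b => .pair (simulate a) (simulate b)
  | comp a b => .comp (simulate a) (.pair .left (simulate b))
  | prec a b => .comp (.prec (simulate a) (.comp (simulate b) assocCode)) unassocCode
  | rfind' a => .comp (.rfind' (.comp (simulate a) assocCode)) unassocCode

/-- The result of running a machine with a finite list as oracle. -/
noncomputable def evalList (l : List ℕ) (c : OracleCode) (n : ℕ) : Part ℕ :=
  c.simulate.eval (Nat.pair (Encodable.encode l) n)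

section evalList

variable (l : List ℕ) (a b : OracleCode) (n : ℕ)

theorem evalList_succ : evalList l succ n = Part.some (n + 1) := by
  simp [evalList, simulate, Code.eval, some_bind_pfun]

theorem evalList_left : evalList l left n = Part.some n.unpair.1 := by
  simp [evalList, simulate, Code.eval, some_bind_pfun]

theorem evalList_right : evalList l right n = Part.some n.unpair.2 := by
  simp [evalList, simulate, Code.eval, some_bind_pfun]

theorem evalList_oracle : evalList l oracle n = (l[n]? : Part ℕ) :=
  eval_lookupCode l n

theorem evalList_pair :
    evalList l (pair a b) n = Nat.pair <$> evalList l a n <*> evalList l b n := rfl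

theorem evalList_comp : evalList l (comp a b) n = evalList l b n >>= evalList l a := by
  simp only [evalList, simulate, Code.eval, Seq.seq]
  simp
  rfl

/-- The list has to be available at every stage of the recursion, so it travels inside the
parameter; the two rearranging codes pack and unpack it. -/
theorem evalList_prec (x m : ℕ) : evalList l (prec a b) (Nat.pair x m) =
    m.rec (evalList l a x) fun y IH => IH >>= fun i => evalList l b (Nat.pair x (Nat.pair y i)) := by
  have h : evalList l (prec a b) (Nat.pair x m) =
      Code.eval (.prec (simulate a) (.comp (simulate b) assocCode))
        (Nat.pair (Nat.pair (Encodable.encode l) x) m) := by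
    change unassocCode.eval _ >>= _ = _
    rw [eval_unassocCode]
    exact Part.bind_some _ _
  rw [h]
  induction m with
  | zero => rw [Code.eval_prec_zero]; rfl
  | succ m ih =>
    rw [Code.eval_prec_succ]
    simp only [Part.bind_eq_bind] at ih ⊢
    rw [ih]
    · congr 1
      funext i
      change assocCode.eval _ >>= _ = _
      rw [eval_assocCode]
      exact Part.bind_some _ _
    · change unassocCode.eval _ >>= _ = _
      rw [eval_unassocCode]
      exact Part.bind_some _ _

theorem evalList_rfind' (x m : ℕ) : evalList l (rfind' a) (Nat.pair x m) =
    (Nat.rfind fun k => (fun j => j = 0) <$> evalList l a (Nat.pair x (k + m))).map (· + m) := by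
  have h : evalList l (rfind' a) (Nat.pair x m) =
      Code.eval (.rfind' (.comp (simulate a) assocCode))
        (Nat.pair (Nat.pair (Encodable.encode l) x) m) := by
    change unassocCode.eval _ >>= _ = _
    rw [eval_unassocCode]
    exact Part.bind_some _ _
  rw [h]
  simp only [Code.eval, Nat.unpaired, Nat.unpair_pair, eval_assocCode, some_bind_pfun]
  rfl

end evalList

/-- A run with a finite part of the oracle agrees with the run with the full oracle. -/
theorem mem_eval_of_mem_evalList {A : ℕ → ℕ} {l : List ℕ}
    (hl : ∀ i v, l[i]? = some v → A i = v) (c : OracleCode) :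
    ∀ {n x : ℕ}, x ∈ evalList l c n → x ∈ c.eval A n := by
  induction c with
  | zero => intro n x h; exact h
  | succ => intro n x h; rw [evalList_succ] at h; exact h
  | left => intro n x h; rw [evalList_left] at h; exact h
  | right => intro n x h; rw [evalList_right] at h; exact h
  | oracle =>
    intro n x h
    rw [evalList_oracle, Part.mem_ofOption] at h
    exact Part.mem_some_iff.2 (hl n x h).symm
  | pair a b iha ihb =>
    intro n x h
    rw [evalList_pair] at h
    simp only [eval, Seq.seq, Part.map_eq_map, Part.mem_bind_iff, Part.mem_map_iff] at h ⊢
    obtain ⟨g, ⟨u, hu, rfl⟩, v, hv, rfl⟩ := h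
    exact ⟨_, ⟨u, iha hu, rfl⟩, v, ihb hv, rfl⟩
  | comp a b iha ihb =>
    intro n x h
    rw [evalList_comp] at h
    obtain ⟨u, hu, hx⟩ := mem_bind_pfun.1 h
    exact mem_bind_pfun.2 ⟨u, ihb hu, iha hx⟩
  | prec a b iha ihb =>
    intro n x h
    obtain ⟨y, m, rfl⟩ : ∃ y m, n = Nat.pair y m := ⟨_, _, (Nat.pair_unpair n).symm⟩
    rw [evalList_prec] at h
    simp only [eval, Nat.unpaired, Nat.unpair_pair]
    induction m generalizing x with
    | zero => exact iha h
    | succ m ih =>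
      simp only [Part.mem_bind_iff, Part.bind_eq_bind] at h ih ⊢
      obtain ⟨u, hu, hx⟩ := h
      exact ⟨u, ih hu, ihb hx⟩
  | rfind' a iha =>
    intro n x h
    obtain ⟨y, m, rfl⟩ : ∃ y m, n = Nat.pair y m := ⟨_, _, (Nat.pair_unpair n).symm⟩
    rw [evalList_rfind'] at h
    rw [mem_map_rfind] at h
    simp only [eval, Nat.unpaired, Nat.unpair_pair]
    rw [mem_map_rfind]
    obtain ⟨k, hj, hk, rfl⟩ := h
    refine ⟨k, iha hj, fun i hi => ?_, rfl⟩
    obtain ⟨j, hj, hj'⟩ := hk i hi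
    exact ⟨j, iha hj, hj'⟩

/-- The use principle: a halting run needs only a finite part of the oracle. -/
theorem eventually_mem_evalList (A : ℕ → ℕ) (c : OracleCode) :
    ∀ {n x : ℕ}, x ∈ c.eval A n → ∀ᶠ m in atTop, x ∈ evalList (oraclePrefix A m) c n := by
  induction c with
  | zero => intro n x h; exact Eventually.of_forall fun _ => h
  | succ => intro n x h; simp only [evalList_succ]; exact Eventually.of_forall fun _ => h
  | left => intro n x h; simp only [evalList_left]; exact Eventually.of_forall fun _ => h
  | right => intro n x h; simp only [evalList_right]; exact Eventually.of_forall fun _ => h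
  | oracle =>
    intro n x h
    filter_upwards [eventually_gt_atTop n] with m hm
    rw [evalList_oracle, Part.mem_ofOption]
    exact oraclePrefix_getElem?_eq_some.2 ⟨hm, (Part.mem_some_iff.1 h).symm⟩
  | pair a b iha ihb =>
    intro n x h
    simp only [evalList_pair, eval, Seq.seq, Part.map_eq_map, Part.mem_bind_iff, Part.mem_map_iff] at h ⊢
    obtain ⟨g, ⟨u, hu, rfl⟩, v, hv, rfl⟩ := h
    filter_upwards [iha hu, ihb hv] with m hu hv
    exact ⟨_, ⟨u, hu, rfl⟩, v, hv, rfl⟩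
  | comp a b iha ihb =>
    intro n x h
    obtain ⟨u, hu, hx⟩ := mem_bind_pfun.1 h
    filter_upwards [ihb hu, iha hx] with m hu hx
    rw [evalList_comp]
    exact mem_bind_pfun.2 ⟨u, hu, hx⟩
  | prec a b iha ihb =>
    intro n x h
    obtain ⟨y, k, rfl⟩ : ∃ y m, n = Nat.pair y m := ⟨_, _, (Nat.pair_unpair n).symm⟩
    simp only [evalList_prec]
    simp only [eval, Nat.unpaired, Nat.unpair_pair] at h
    induction k generalizing x with
    | zero => exact iha h
    | succ k ih =>
      simp only [Part.mem_bind_iff, Part.bind_eq_bind] at h ih ⊢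
      obtain ⟨u, hu, hx⟩ := h
      filter_upwards [ih hu, ihb hx] with m hu hx
      exact ⟨u, hu, hx⟩
  | rfind' a iha =>
    intro n x h
    obtain ⟨y, k, rfl⟩ : ∃ y m, n = Nat.pair y m := ⟨_, _, (Nat.pair_unpair n).symm⟩
    simp only [eval, Nat.unpaired, Nat.unpair_pair] at h
    rw [mem_map_rfind] at h
    simp only [evalList_rfind', mem_map_rfind]
    obtain ⟨i, hj, hi, rfl⟩ := h
    -- The search makes only finitely many tests before it succeeds, so one prefix length serves
    -- them all.
    have hlt : ∀ᶠ m in atTop, ∀ t ∈ {t | t < i},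
        ∃ j ∈ evalList (oraclePrefix A m) a (Nat.pair y (t + k)), j ≠ 0 := by
      refine (eventually_all_finite (Set.finite_lt_nat i)).2 fun t ht => ?_
      obtain ⟨j, hj, hj'⟩ := hi t ht
      filter_upwards [iha hj] with m hm
      exact ⟨j, hm, hj'⟩
    filter_upwards [iha hj, hlt] with m hm hlt
    exact ⟨i, hm, hlt, rfl⟩

/-- `simulate` as a function of the number of a code, in terms of the list of its previous
values. -/
noncomputable def simulateStep (h : List Code) : Code :=
  -- The length of the table is the number being decoded. Quotient and remainder invert `toNat`; the
  -- offset 8 of `rfind'` is `5 + 3`, which gives remainder 3 and makes `m` itself the component.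
  let m := (h.length - 5) / 4
  let a := h.getD m.unpair.1 .zero
  let b := h.getD m.unpair.2 .zero
  if h.length = 0 then .zero
  else if h.length = 1 then .comp .succ .right
  else if h.length = 2 then .comp .left .right
  else if h.length = 3 then .comp .right .right
  else if h.length = 4 then lookupCode
  else if (h.length - 5) % 4 = 0 then .pair a b
  else if (h.length - 5) % 4 = 1 then .comp a (.pair .left b)
  else if (h.length - 5) % 4 = 2 then .comp (.prec a (.comp b assocCode)) unassocCode
  else .comp (.rfind' (.comp (h.getD m .zero) assocCode)) unassocCode

theorem primrec_simulateStep : Primrec simulateStep := by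
  have hl : Primrec fun h : List Code => h.length := Primrec.list_length
  have hs : Primrec fun h : List Code => h.length - 5 := Primrec.nat_sub.comp hl (Primrec.const 5)
  have hm : Primrec fun h : List Code => (h.length - 5) / 4 :=
    Primrec.nat_div.comp hs (Primrec.const 4)
  have hr : Primrec fun h : List Code => (h.length - 5) % 4 :=
    Primrec.nat_mod.comp hs (Primrec.const 4)
  have ha : Primrec fun h : List Code => h.getD ((h.length - 5) / 4).unpair.1 Code.zero :=
    (Primrec.list_getD Code.zero).comp Primrec.id (Primrec.fst.comp (Primrec.unpair.comp hm))
  have hb : Primrec fun h : List Code => h.getD ((h.length - 5) / 4).unpair.2 Code.zero :=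
    (Primrec.list_getD Code.zero).comp Primrec.id (Primrec.snd.comp (Primrec.unpair.comp hm))
  have hc : Primrec fun h : List Code => h.getD ((h.length - 5) / 4) Code.zero :=
    (Primrec.list_getD Code.zero).comp Primrec.id hm
  have hk (c : Code) : Primrec fun _ : List Code => c := Primrec.const c
  have el (n : ℕ) : PrimrecPred fun h : List Code => h.length = n :=
    Primrec.eq.comp hl (Primrec.const n)
  have er (n : ℕ) : PrimrecPred fun h : List Code => (h.length - 5) % 4 = n :=
    Primrec.eq.comp hr (Primrec.const n)
  refine Primrec.ite (el 0) (hk _) <| Primrec.ite (el 1) (hk _) <| Primrec.ite (el 2) (hk _) <|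
    Primrec.ite (el 3) (hk _) <| Primrec.ite (el 4) (hk _) <|
    Primrec.ite (er 0) (Code.primrec₂_pair.comp ha hb) <|
    Primrec.ite (er 1) (Code.primrec₂_comp.comp ha (Code.primrec₂_pair.comp (hk _) hb)) <|
    Primrec.ite (er 2) (Code.primrec₂_comp.comp
      (Code.primrec₂_prec.comp ha (Code.primrec₂_comp.comp hb (hk _))) (hk _)) <|
    Code.primrec₂_comp.comp
      (Code.primrec_rfind'.comp (Code.primrec₂_comp.comp hc (hk _))) (hk _)

/-- The list of the first `n` values of `simulate` on numbers of codes. -/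
noncomputable def simulateTable : ℕ → List Code
  | 0 => []
  | n + 1 => simulateTable n ++ [simulateStep (simulateTable n)]

/-- `simulate` as a function of the number of a code. -/
noncomputable def simulateNat (n : ℕ) : Code :=
  simulateStep (simulateTable n)

theorem primrec_simulateNat : Primrec simulateNat := by
  have h : Primrec simulateTable := by
    refine (Primrec.nat_rec₁ (f := fun _ l => l ++ [simulateStep l]) [] ?_).of_eq fun n => ?_
    · exact Primrec.list_concat.comp Primrec.snd (primrec_simulateStep.comp Primrec.snd)
    · induction n with
      | zero => rfl
      | succ n ih => simp only [simulateTable, ← ih]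
  exact primrec_simulateStep.comp h

theorem simulateTable_eq (n : ℕ) : simulateTable n = (List.range n).map simulateNat := by
  induction n with
  | zero => rfl
  | succ n ih => rw [simulateTable, List.range_succ, List.map_append, ← ih]; rfl

theorem getD_simulateTable {n m : ℕ} (h : m < n) :
    (simulateTable n).getD m Code.zero = simulateNat m := by
  simp [simulateTable_eq, List.getD, h]

/-- The components of a code have smaller numbers than the code, so their translations already stand
in the table. -/
theorem simulateNat_toNat (c : OracleCode) : simulateNat c.toNat = c.simulate := by
  have hlen (n : ℕ) : (simulateTable n).length = n := by simp [simulateTable_eq]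
  induction c with
  | zero | succ | left | right | oracle =>
    simp [simulateNat, simulateStep, hlen, toNat, simulate]
  | pair a b iha ihb | comp a b iha ihb | prec a b iha ihb =>
    have h1 := Nat.left_le_pair a.toNat b.toNat
    have h2 := Nat.right_le_pair a.toNat b.toNat
    have hm : ∀ r < 4, (4 * Nat.pair a.toNat b.toNat + (5 + r) - 5) / 4 =
      Nat.pair a.toNat b.toNat := fun r hr => by omega
    have hr : ∀ r < 4, (4 * Nat.pair a.toNat b.toNat + (5 + r) - 5) % 4 = r :=
      fun r hr => by omega
    have hm0 := hm 0 (by norm_num)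
    have hm1 := hm 1 (by norm_num)
    have hm2 := hm 2 (by norm_num)
    have hr0 := hr 0 (by norm_num)
    have hr1 := hr 1 (by norm_num)
    have hr2 := hr 2 (by norm_num)
    norm_num only at hm0 hm1 hm2 hr0 hr1 hr2
    simp only [simulateNat, simulateStep, hlen, toNat, simulate, hm0, hm1, hm2, hr0, hr1, hr2,
      Nat.unpair_pair]
    rw [getD_simulateTable (by omega), getD_simulateTable (by omega), iha, ihb]
    simp
  | rfind' a iha =>
    have hm : (4 * a.toNat + 8 - 5) / 4 = a.toNat := by omega
    have hr : (4 * a.toNat + 8 - 5) % 4 = 3 := by omega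
    simp only [simulateNat, simulateStep, hlen, toNat, simulate, hm, hr]
    rw [getD_simulateTable (m := a.toNat) (by omega), iha]
    simp

end OracleCode

/-! ### Semidecidability relative to an oracle -/

theorem oraclePrefix_succ (A : ℕ → ℕ) (n : ℕ) :
    oraclePrefix A (n + 1) = oraclePrefix A n ++ [A n] := by
  simp [oraclePrefix, List.range_succ]

/-- The relation `P A a` is semidecidable, uniformly in the oracle `A`: it holds if and only if a
primitive recursive test accepts `a` and some, equivalently every sufficiently long, initial segment
of `A`. -/
def OracleSemidecidable {α : Type*} [Primcodable α] (P : (ℕ → ℕ) → α → Prop) : Prop :=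
  ∃ Q : List ℕ → α → Prop, PrimrecRel Q ∧
    (∀ A a, Monotone fun n => Q (oraclePrefix A n) a) ∧
    ∀ A a, P A a ↔ ∃ n, Q (oraclePrefix A n) a

namespace OracleSemidecidable

variable {α β : Type*} [Primcodable α] [Primcodable β]

theorem of_iff {P P' : (ℕ → ℕ) → α → Prop} (h : OracleSemidecidable P)
    (H : ∀ A a, P A a ↔ P' A a) : OracleSemidecidable P' := by
  have : P = P' := by funext A a; exact propext (H A a)
  exact this ▸ h

theorem of_primrecPred {R : α → Prop} (h : PrimrecPred R) :
    OracleSemidecidable fun _ a => R a :=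
  ⟨fun _ a => R a, h.comp Primrec.snd, fun _ _ _ _ _ hR => hR, fun _ _ => by simp⟩

theorem comp {P : (ℕ → ℕ) → α → Prop} (h : OracleSemidecidable P) {f : β → α}
    (hf : Primrec f) : OracleSemidecidable fun A b => P A (f b) := by
  obtain ⟨Q, hQ, hm, hP⟩ := h
  exact ⟨fun l b => Q l (f b), PrimrecRel.comp hQ Primrec.fst (hf.comp Primrec.snd),
    fun A b => hm A (f b), fun A b => hP A (f b)⟩

theorem and {P P' : (ℕ → ℕ) → α → Prop} (h : OracleSemidecidable P)
    (h' : OracleSemidecidable P') : OracleSemidecidable fun A a => P A a ∧ P' A a := by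
  obtain ⟨Q, hQ, hm, hP⟩ := h
  obtain ⟨Q', hQ', hm', hP'⟩ := h'
  refine ⟨fun l a => Q l a ∧ Q' l a, PrimrecPred.and hQ hQ',
    fun A a i j hij hi => ⟨hm A a hij hi.1, hm' A a hij hi.2⟩, fun A a => ?_⟩
  simp only [hP, hP']
  constructor
  · rintro ⟨⟨i, hi⟩, j, hj⟩
    exact ⟨max i j, hm A a (le_max_left i j) hi, hm' A a (le_max_right i j) hj⟩
  · rintro ⟨i, hi, hi'⟩
    exact ⟨⟨i, hi⟩, i, hi'⟩

theorem or {P P' : (ℕ → ℕ) → α → Prop} (h : OracleSemidecidable P)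
    (h' : OracleSemidecidable P') : OracleSemidecidable fun A a => P A a ∨ P' A a := by
  obtain ⟨Q, hQ, hm, hP⟩ := h
  obtain ⟨Q', hQ', hm', hP'⟩ := h'
  refine ⟨fun l a => Q l a ∨ Q' l a, PrimrecPred.or hQ hQ',
    fun A a i j hij hi => hi.imp (hm A a hij) (hm' A a hij), fun A a => ?_⟩
  simp only [hP, hP', exists_or]

/-- Bounding the witness by the length of the prefix keeps the test primitive recursive and
monotone; a longer prefix eventually admits any witness. -/
theorem exists_nat {P : (ℕ → ℕ) → α × ℕ → Prop} (h : OracleSemidecidable P) :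
    OracleSemidecidable fun A a => ∃ b, P A (a, b) := by
  obtain ⟨Q, hQ, hm, hP⟩ := h
  refine ⟨fun l a => ∃ b < l.length, Q l (a, b), ?_, fun A a i j hij hi => ?_, fun A a => ?_⟩
  · have hR : PrimrecRel fun (b : ℕ) (x : List ℕ × α) => Q x.1 (x.2, b) :=
      PrimrecRel.comp hQ (Primrec.fst.comp Primrec.snd)
        (Primrec.pair (Primrec.snd.comp Primrec.snd) Primrec.fst)
    exact (PrimrecRel.comp hR.exists_mem_list (Primrec.list_range.comp
      (Primrec.list_length.comp Primrec.fst)) Primrec.id).of_eq fun x => by simp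
  · obtain ⟨b, hb, hbQ⟩ := hi
    rw [length_oraclePrefix] at hb
    exact ⟨b, by rw [length_oraclePrefix]; omega, hm A _ hij hbQ⟩
  · simp only [hP, length_oraclePrefix]
    constructor
    · rintro ⟨b, n, hn⟩
      exact ⟨max n (b + 1), b, by omega, hm A _ (le_max_left _ _) hn⟩
    · rintro ⟨n, b, -, hb⟩
      exact ⟨b, n, hb⟩

theorem exists_list {P : (ℕ → ℕ) → α × List ℕ → Prop} (h : OracleSemidecidable P) :
    OracleSemidecidable fun A a => ∃ l, P A (a, l) := by
  refine (exists_nat (P := fun A x => P A (x.1, Denumerable.ofNat (List ℕ) x.2)) (h.comp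
    (Primrec.pair Primrec.fst ((Primrec.ofNat (List ℕ)).comp Primrec.snd)))).of_iff fun A a => ?_
  constructor
  · rintro ⟨n, hn⟩
    exact ⟨_, hn⟩
  · rintro ⟨b, hb⟩
    exact ⟨Encodable.encode b, by simpa using hb⟩

/-- Monotonicity in the prefix lets one long prefix accept all of the finitely many instances at
once. -/
theorem forall_lt {P : (ℕ → ℕ) → α × ℕ → Prop} (h : OracleSemidecidable P) {g : α → ℕ}
    (hg : Primrec g) : OracleSemidecidable fun A a => ∀ b < g a, P A (a, b) := by
  obtain ⟨Q, hQ, hm, hP⟩ := h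
  refine ⟨fun l a => ∀ b < g a, Q l (a, b), ?_,
    fun A a i j hij hi b hb => hm A _ hij (hi b hb), fun A a => ?_⟩
  · have hR : PrimrecRel fun (b : ℕ) (x : List ℕ × α) => Q x.1 (x.2, b) :=
      PrimrecRel.comp hQ (Primrec.fst.comp Primrec.snd)
        (Primrec.pair (Primrec.snd.comp Primrec.snd) Primrec.fst)
    exact (PrimrecRel.comp hR.forall_mem_list (Primrec.list_range.comp
      (hg.comp Primrec.snd)) Primrec.id).of_eq fun x => by simp
  · simp only [hP]
    constructor
    · intro H
      have : ∀ᶠ n in atTop, ∀ b ∈ {b | b < g a}, Q (oraclePrefix A n) (a, b) := by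
        refine (eventually_all_finite (Set.finite_lt_nat (g a))).2 fun b hb => ?_
        obtain ⟨n, hn⟩ := H b hb
        filter_upwards [eventually_ge_atTop n] with m hnm
        exact hm A _ hnm hn
      exact this.exists
    · rintro ⟨n, hn⟩ b hb
      exact ⟨n, hn b hb⟩

theorem oracle_eq : OracleSemidecidable fun A (x : ℕ × ℕ) => A x.1 = x.2 := by
  refine ⟨fun l x => l[x.1]? = some x.2, ?_, fun A a i j hij hi => ?_, fun A a => ?_⟩
  · exact Primrec.eq.comp (Primrec.list_getElem?.comp Primrec.fst (Primrec.fst.comp Primrec.snd))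
      (Primrec.option_some.comp (Primrec.snd.comp Primrec.snd))
  · have := oraclePrefix_getElem?_eq_some.1 hi
    exact oraclePrefix_getElem?_eq_some.2 ⟨by omega, this.2⟩
  · simp only [oraclePrefix_getElem?_eq_some]
    exact ⟨fun h => ⟨a.1 + 1, by omega, h⟩, fun ⟨_, _, h⟩ => h⟩

/-- The value of a partial recursive function is semidecidable. -/
theorem mem_eval : OracleSemidecidable fun _ (x : (Code × ℕ) × ℕ) => x.2 ∈ x.1.1.eval x.1.2 := by
  have h : PrimrecPred fun x : ((Code × ℕ) × ℕ) × ℕ =>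
      Code.evaln x.2 x.1.1.1 x.1.1.2 = some x.1.2 :=
    Primrec.eq.comp (Code.primrec_evaln.comp (Primrec.pair (Primrec.pair Primrec.snd
      (Primrec.fst.comp (Primrec.fst.comp Primrec.fst)))
      (Primrec.snd.comp (Primrec.fst.comp Primrec.fst))))
      (Primrec.option_some.comp (Primrec.snd.comp Primrec.fst))
  refine (of_primrecPred h).exists_nat.of_iff fun _ x => ?_
  rw [Code.evaln_complete]
  rfl

end OracleSemidecidable

/-! ### Oracle machines from primitive recursive functions -/

namespace OracleCode

/-- An oracle-free code as an oracle code. -/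
def ofCode : Code → OracleCode
  | .zero => zero
  | .succ => succ
  | .left => left
  | .right => right
  | .pair a b => pair (ofCode a) (ofCode b)
  | .comp a b => comp (ofCode a) (ofCode b)
  | .prec a b => prec (ofCode a) (ofCode b)
  | .rfind' a => rfind' (ofCode a)

theorem eval_ofCode (A : ℕ → ℕ) (c : Code) : (ofCode c).eval A = c.eval := by
  induction c with
  | zero | succ | left | right => rfl
  | pair a b iha ihb | comp a b iha ihb | prec a b iha ihb =>
    simp only [ofCode, eval, Code.eval, iha, ihb]
    rfl
  | rfind' a iha =>
    simp only [ofCode, eval, Code.eval, iha]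
    rfl

theorem exists_ofCode_of_primrec {f : ℕ → ℕ} (hf : Primrec f) :
    ∃ c : OracleCode, ∀ A n, c.eval A n = Part.some (f n) := by
  obtain ⟨c, hc⟩ := Code.exists_code.1 (Nat.Partrec.of_primrec (Primrec.nat_iff.1 hf))
  exact ⟨ofCode c, fun A n => by rw [eval_ofCode, hc]; rfl⟩

theorem eval_pair_of_eq {A : ℕ → ℕ} {a b : OracleCode} {n x y : ℕ}
    (ha : a.eval A n = Part.some x) (hb : b.eval A n = Part.some y) :
    (pair a b).eval A n = Part.some (Nat.pair x y) := by
  simp [eval, ha, hb, Seq.seq]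

theorem eval_comp_of_eq {A : ℕ → ℕ} {a b : OracleCode} {n x : ℕ}
    (hb : b.eval A n = Part.some x) : (comp a b).eval A n = a.eval A x := by
  simp only [eval, hb]
  exact some_bind_pfun _ _

/-- One machine computes the initial segments of every oracle. -/
theorem exists_prefixCode :
    ∃ c : OracleCode, ∀ A n, c.eval A n = Part.some (Encodable.encode (oraclePrefix A n)) := by
  -- The input of `g` is `((a, (y, i)), A y)`: the dummy parameter, the stage and the encoded prefix
  -- so far, then the symbol to append. The recursion may start at `zero` because the empty list is
  -- encoded by `0`.
  obtain ⟨g, hg⟩ := exists_ofCode_of_primrec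
    (f := fun m => Encodable.encode
      (Denumerable.ofNat (List ℕ) m.unpair.1.unpair.2.unpair.2 ++ [m.unpair.2])) <| by
    have hu (i : ℕ → ℕ) (hi : Primrec i) : Primrec fun m => (i m).unpair.1 :=
      Primrec.fst.comp (Primrec.unpair.comp hi)
    have hv (i : ℕ → ℕ) (hi : Primrec i) : Primrec fun m => (i m).unpair.2 :=
      Primrec.snd.comp (Primrec.unpair.comp hi)
    exact Primrec.encode.comp (Primrec.list_concat.comp
      ((Primrec.ofNat (List ℕ)).comp (hv _ (hv _ (hu _ Primrec.id)))) (hv _ Primrec.id))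
  obtain ⟨i, hi⟩ := exists_ofCode_of_primrec (f := id) Primrec.id
  obtain ⟨s, hs⟩ := exists_ofCode_of_primrec (f := fun m => m.unpair.2.unpair.1)
    (Primrec.fst.comp (Primrec.unpair.comp (Primrec.snd.comp Primrec.unpair)))
  refine ⟨comp (prec zero (comp g (pair i (comp oracle s)))) (pair zero i), fun A n => ?_⟩
  rw [eval_comp_of_eq (eval_pair_of_eq rfl (hi A n))]
  simp only [eval, Nat.unpaired, Nat.unpair_pair, id]
  induction n with
  | zero => rfl
  | succ n ih =>
    simp only [ih]
    refine (Part.bind_some _ _).trans ?_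
    refine (eval_comp_of_eq (b := pair i (comp oracle s)) (eval_pair_of_eq (hi A _)
      (eval_comp_of_eq (hs A _)))).trans ?_
    rw [hg, oraclePrefix_succ]
    simp

end OracleCode

/-- A relation that is semidecidable uniformly in the oracle is enumerated by one machine. -/
theorem OracleSemidecidable.exists_machine {P : (ℕ → ℕ) → ℕ → Prop}
    (h : OracleSemidecidable P) : ∃ M : OracleCode, ∀ A, ∃ q : ℕ → ℕ, M.Computes A q ∧
      ∀ k, P A k ↔ ∃ n, q n = k + 1 := by
  classical
  obtain ⟨Q, hQ, hm, hP⟩ := h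
  -- Output cell `n` tests the candidate `n.unpair.1` on the prefix of length `n` and stays blank if
  -- the test fails.
  let F : ℕ → ℕ → ℕ := fun n l => if Q (Denumerable.ofNat (List ℕ) l) n.unpair.1
    then n.unpair.1 + 1 else 0
  have hu : Primrec fun m : ℕ => m.unpair.1 := Primrec.fst.comp Primrec.unpair
  have hv : Primrec fun m : ℕ => m.unpair.2 := Primrec.snd.comp Primrec.unpair
  have hF : Primrec fun m : ℕ => F m.unpair.1 m.unpair.2 :=
    Primrec.ite (PrimrecRel.comp hQ ((Primrec.ofNat (List ℕ)).comp hv) (hu.comp hu))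
      (Primrec.succ.comp (hu.comp hu)) (Primrec.const 0)
  obtain ⟨c, hc⟩ := OracleCode.exists_ofCode_of_primrec hF
  obtain ⟨i, hi⟩ := OracleCode.exists_ofCode_of_primrec (f := id) Primrec.id
  obtain ⟨s, hs⟩ := OracleCode.exists_prefixCode
  refine ⟨.comp c (.pair i s), fun A =>
    ⟨fun n => F n (Encodable.encode (oraclePrefix A n)), fun n => ?_, fun k => ?_⟩⟩
  · rw [OracleCode.eval_comp_of_eq (OracleCode.eval_pair_of_eq (hi A n) (hs A n)), hc]
    simp
  · simp only [F, Denumerable.ofNat_encode, hP]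
    constructor
    · rintro ⟨n, hn⟩
      -- This cell tests `k`, and its prefix has length at least `n`.
      refine ⟨Nat.pair k n, ?_⟩
      simp [hm A k (Nat.right_le_pair k n) hn]
    · rintro ⟨n, hn⟩
      split_ifs at hn with hQn
      · obtain rfl : n.unpair.1 = k := by omega
        exact ⟨n, hQn⟩

open Topology

/-! ### The open mapping theorem on the sphere -/

@[simp]
theorem finitePart_coe (z : ℂ) : finitePart (z : RiemannSphere) = z := rfl

@[simp]
theorem finitePart_infty : finitePart OnePoint.infty = 0 := rfl

@[simp]
theorem infinityChart_zero : infinityChart 0 = OnePoint.infty := by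
  simp [infinityChart]

theorem infinityChart_of_ne_zero {w : ℂ} (hw : w ≠ 0) :
    infinityChart w = ((w⁻¹ : ℂ) : RiemannSphere) := by
  simp [infinityChart, hw]

theorem inv_finitePart_infinityChart (w : ℂ) : (finitePart (infinityChart w))⁻¹ = w := by
  by_cases hw : w = 0
  · simp [hw]
  · simp [infinityChart_of_ne_zero hw]

/-- Inversion exchanges punctured neighborhoods of `0` with complements of compact sets, and `0`
itself goes to `∞`. -/
theorem map_infinityChart_nhds_zero :
    map infinityChart (𝓝 0) = 𝓝 (OnePoint.infty : RiemannSphere) := by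
  have h : map infinityChart (𝓝[≠] 0) =
      map (fun z : ℂ => (z : RiemannSphere)) (coclosedCompact ℂ) := by
    rw [coclosedCompact_eq_cocompact, ← Metric.cobounded_eq_cocompact, ← inv_nhdsNE_zero,
      ← Filter.map_inv, Filter.map_map]
    refine Filter.map_congr ?_
    filter_upwards [self_mem_nhdsWithin] with w hw
    exact infinityChart_of_ne_zero hw
  rw [OnePoint.nhds_infty_eq, ← h, ← nhdsNE_sup_pure, Filter.map_sup, Filter.map_pure, infinityChart_zero]

/-- The local open mapping theorem for a map that is analytic in a chart of its target. -/
theorem eventually_constant_or_nhds_le_map_of_chart {g : ℂ → RiemannSphere} {z₀ w₀ : ℂ}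
    {χ : ℂ → RiemannSphere} {ψ : RiemannSphere → ℂ} (hψ : Function.LeftInverse ψ χ)
    (hχ : map χ (𝓝 w₀) = 𝓝 (g z₀)) (hw : χ w₀ = g z₀) (hc : ContinuousAt g z₀)
    (hm : MeromorphicAt (fun w => ψ (g w)) z₀) :
    (∀ᶠ w in 𝓝 z₀, g w = g z₀) ∨
      𝓝 (g z₀) ≤ map g (𝓝 z₀) ∧ ∀ᶠ w in 𝓝 z₀, g w = g z₀ → w = z₀ := by
  have hw' : ψ (g z₀) = w₀ := by rw [← hw, hψ]
  -- Near `g z₀` every point comes from the chart, on which `ψ` is the inverse.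
  have hψc : ContinuousAt ψ (g z₀) := by
    rw [ContinuousAt, ← hχ, hw', tendsto_map'_iff]
    exact tendsto_id.congr fun w => (hψ w).symm
  have hχψ : ∀ᶠ y in 𝓝 (g z₀), χ (ψ y) = y := by
    rw [← hχ, eventually_map]
    exact Eventually.of_forall fun w => by rw [hψ]
  have hg : ∀ᶠ w in 𝓝 z₀, χ (ψ (g w)) = g w := hc.eventually hχψ
  -- Continuity removes the singularity and fixes the correct value.
  have ha : AnalyticAt ℂ (fun w => ψ (g w)) z₀ := hm.analyticAt (hψc.comp hc)
  have hconst : (∀ᶠ w in 𝓝 z₀, ψ (g w) = ψ (g z₀)) → ∀ᶠ w in 𝓝 z₀, g w = g z₀ := by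
    intro h
    filter_upwards [h, hg] with w h1 h2
    rw [← h2, h1, hw', hw]
  rcases ha.eventually_constant_or_nhds_le_map_nhds with h | h
  · exact Or.inl (hconst h)
  rcases ha.eventually_eq_or_eventually_ne (analyticAt_const (v := ψ (g z₀))) with h' | h'
  · exact Or.inl (hconst h')
  · refine Or.inr ⟨?_, ?_⟩
    · rw [hw'] at h
      calc 𝓝 (g z₀) = map χ (𝓝 w₀) := hχ.symm
        _ ≤ map χ (map (fun w => ψ (g w)) (𝓝 z₀)) := map_mono h
        _ = map g (𝓝 z₀) := by rw [Filter.map_map]; exact Filter.map_congr hg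
    · rw [eventually_nhdsWithin_iff] at h'
      filter_upwards [h'] with w hw1 hw2
      by_contra hne
      exact hw1 hne (by rw [hw2])

theorem eventually_constant_or_nhds_le_map_of_meromorphicAt {g : ℂ → RiemannSphere} {z₀ : ℂ}
    (hc : ContinuousAt g z₀) (hm : MeromorphicAt (fun w => finitePart (g w)) z₀) :
    (∀ᶠ w in 𝓝 z₀, g w = g z₀) ∨
      𝓝 (g z₀) ≤ map g (𝓝 z₀) ∧ ∀ᶠ w in 𝓝 z₀, g w = g z₀ → w = z₀ := by
  by_cases h : g z₀ = OnePoint.infty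
  -- The conventions `finitePart ∞ = 0` and `0⁻¹ = 0` give this coordinate the value `0` at `∞`. It
  -- is also `0` at the finite point `0`, which is harmless: only a left inverse of the chart is
  -- required.
  · exact eventually_constant_or_nhds_le_map_of_chart (ψ := fun y => (finitePart y)⁻¹)
      inv_finitePart_infinityChart (by rw [map_infinityChart_nhds_zero, h]) (by simp [h]) hc hm.inv
  · obtain ⟨w₀, hw₀⟩ := OnePoint.ne_infty_iff_exists.1 h
    exact eventually_constant_or_nhds_le_map_of_chart finitePart_coe
      (by rw [← hw₀, OnePoint.nhds_coe_eq]) hw₀ hc hm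

/-! ### The identity theorem and openness of images -/

namespace IsMeromorphicOn

variable {f : RiemannSphere → RiemannSphere} {D : Set RiemannSphere}

theorem continuousAt (hf : IsMeromorphicOn f D) {x : RiemannSphere} (hx : x ∈ D) :
    ContinuousAt f x :=
  hf.continuousOn.continuousAt (hf.isOpen_domain.mem_nhds hx)

theorem eventually_constant_or_nhds_le_map (hf : IsMeromorphicOn f D) {x : RiemannSphere}
    (hx : x ∈ D) : (∀ᶠ y in 𝓝 x, f y = f x) ∨
      𝓝 (f x) ≤ map f (𝓝 x) ∧ ∀ᶠ y in 𝓝 x, f y = f x → y = x := by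
  have key : ∀ (χ : ℂ → RiemannSphere) (z : ℂ), χ z = x → map χ (𝓝 z) = 𝓝 x →
      MeromorphicAt (fun w => finitePart (f (χ w))) z →
      (∀ᶠ y in 𝓝 x, f y = f x) ∨
        𝓝 (f x) ≤ map f (𝓝 x) ∧ ∀ᶠ y in 𝓝 x, f y = f x → y = x := by
    rintro χ z rfl hχ hm
    have hc : ContinuousAt (fun w => f (χ w)) z :=
      (hf.continuousAt hx).tendsto.comp hχ.le
    rw [← hχ, Filter.map_map, eventually_map, eventually_map]
    refine (eventually_constant_or_nhds_le_map_of_meromorphicAt hc hm).imp_right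
      fun h => ⟨h.1, h.2.mono fun w hw hw' => by rw [hw hw']⟩
  induction x using OnePoint.rec with
  | infty =>
    exact key infinityChart 0 infinityChart_zero map_infinityChart_nhds_zero
      (hf.meromorphicAt_infty hx)
  | coe z =>
    exact key (fun w => (w : RiemannSphere)) z rfl (OnePoint.nhds_coe_eq z).symm
      (hf.meromorphicAt_finite z hx)

/-- The identity theorem: a meromorphic function that is non-constant on the components of its
domain is nowhere locally constant. -/
theorem not_eventually_constant (hf : IsMeromorphicOn f D) (hn : IsNonconstantOn f D)
    {x : RiemannSphere} (hx : x ∈ D) : ¬ ∀ᶠ y in 𝓝 x, f y = f x := by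
  intro h
  obtain ⟨y, hy, hyx⟩ := hn x hx
  -- The set of points near which `f` is identically `f x` is open, and the component is connected;
  -- it remains to show that the set is relatively closed.
  have hsub : connectedComponentIn D x ⊆ {y | ∀ᶠ w in 𝓝 y, f w = f x} := by
    refine isPreconnected_connectedComponentIn.subset_of_closure_inter_subset
      isOpen_setOfPred_eventually_nhds ⟨x, mem_connectedComponentIn hx, h⟩ ?_
    rintro z ⟨hz, hzD⟩
    have hzD := connectedComponentIn_subset D x hzD
    have hfreq : ∃ᶠ w in 𝓝 z, ∀ᶠ u in 𝓝 w, f u = f x := mem_closure_iff_frequently.1 hz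
    have hfz : f z = f x := by
      by_contra hne
      have := (hf.continuousAt hzD).eventually_ne hne
      obtain ⟨w, hw, hw'⟩ := (hfreq.and_eventually this).exists
      exact hw' hw.self_of_nhds
    rcases hf.eventually_constant_or_nhds_le_map hzD with h' | ⟨-, h'⟩
    · exact h'.mono fun w hw => hw.trans hfz
    -- If the fibre is isolated at `z`, a nearby point `w` of the set can only be `z` itself.
    · obtain ⟨w, hw, hw'⟩ := (hfreq.and_eventually h').exists
      have := hw' (hw.self_of_nhds.trans hfz.symm)
      exact this ▸ hw
  exact hyx (hsub hy).self_of_nhds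

theorem nhds_le_map (hf : IsMeromorphicOn f D) (hn : IsNonconstantOn f D)
    {x : RiemannSphere} (hx : x ∈ D) : 𝓝 (f x) ≤ map f (𝓝 x) :=
  ((hf.eventually_constant_or_nhds_le_map hx).resolve_left (hf.not_eventually_constant hn hx)).1

theorem eventually_eq_imp_eq (hf : IsMeromorphicOn f D) (hn : IsNonconstantOn f D)
    {x : RiemannSphere} (hx : x ∈ D) : ∀ᶠ y in 𝓝 x, f y = f x → y = x :=
  ((hf.eventually_constant_or_nhds_le_map hx).resolve_left (hf.not_eventually_constant hn hx)).2

theorem isOpen_image (hf : IsMeromorphicOn f D) (hn : IsNonconstantOn f D)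
    {U : Set RiemannSphere} (hU : IsOpen U) (hUD : U ⊆ D) : IsOpen (f '' U) := by
  rw [isOpen_iff_mem_nhds]
  rintro _ ⟨x, hx, rfl⟩
  exact hf.nhds_le_map hn (hUD hx) (image_mem_map (hU.mem_nhds hx))

end IsMeromorphicOn

/-! ### Topology of the basic sets -/

theorem isOpen_openRect (a b c d : ℚ) : IsOpen (openRect a b c d) := by
  refine OnePoint.isOpen_image_coe.2 ?_
  exact (isOpen_lt continuous_const Complex.continuous_re).inter <|
    (isOpen_lt Complex.continuous_re continuous_const).inter <|
    (isOpen_lt continuous_const Complex.continuous_im).inter <|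
    isOpen_lt Complex.continuous_im continuous_const

theorem isOpen_diskExterior (r : ℚ) : IsOpen (diskExterior r) :=
  OnePoint.isOpen_compl_image_coe.2 ⟨Metric.isClosed_closedBall, isCompact_closedBall _ _⟩

theorem isPreconnected_openRect (a b c d : ℚ) : IsPreconnected (openRect a b c d) := by
  refine IsPreconnected.image ?_ _ OnePoint.continuous_coe.continuousOn
  refine Convex.isPreconnected ?_
  exact (convex_halfSpace_re_gt _).inter <| (convex_halfSpace_re_lt _).inter <|
    (convex_halfSpace_im_gt _).inter (convex_halfSpace_im_lt _)

theorem continuous_infinityChart : Continuous infinityChart := by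
  rw [continuous_iff_continuousAt]
  intro w
  by_cases hw : w = 0
  · rw [hw, ContinuousAt, infinityChart_zero, ← map_infinityChart_nhds_zero]
    exact tendsto_map
  · have h : ContinuousAt (fun w : ℂ => ((w⁻¹ : ℂ) : RiemannSphere)) w :=
      OnePoint.continuous_coe.continuousAt.comp (continuousAt_inv₀ hw)
    refine h.congr ?_
    filter_upwards [isOpen_ne.mem_nhds hw] with u hu
    exact (infinityChart_of_ne_zero hu).symm

theorem infinityChart_image_ball {r : ℚ} (hr : 0 < r) :
    infinityChart '' Metric.ball 0 (r : ℝ)⁻¹ = diskExterior r := by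
  have hr' : (0 : ℝ) < r := by exact_mod_cast hr
  ext x
  induction x using OnePoint.rec with
  | infty =>
    refine ⟨fun _ => infty_mem_diskExterior, fun _ => ⟨0, ?_, infinityChart_zero⟩⟩
    simpa using hr'
  | coe z =>
    rw [coe_mem_diskExterior]
    constructor
    · rintro ⟨w, hw, hwz⟩
      have hw0 : w ≠ 0 := by
        rintro rfl
        rw [infinityChart_zero] at hwz
        exact OnePoint.infty_ne_coe _ hwz
      rw [infinityChart_of_ne_zero hw0, OnePoint.coe_eq_coe] at hwz
      rw [← hwz, norm_inv]
      rw [mem_ball_zero_iff] at hw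
      exact (lt_inv_comm₀ (norm_pos_iff.2 hw0) hr').1 hw
    · intro hz
      have hz0 : z ≠ 0 := norm_pos_iff.1 (hr'.trans hz)
      refine ⟨z⁻¹, ?_, ?_⟩
      · rw [mem_ball_zero_iff, norm_inv]
        exact inv_strictAnti₀ hr' hz
      · rw [infinityChart_of_ne_zero (inv_ne_zero hz0), inv_inv]

/-- In the coordinate at infinity the exterior is a disk, hence the continuous image of a convex
set. -/
theorem isPreconnected_diskExterior {r : ℚ} (hr : 0 < r) : IsPreconnected (diskExterior r) := by
  rw [← infinityChart_image_ball hr]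
  exact (convex_ball _ _).isPreconnected.image _ continuous_infinityChart.continuousOn

theorem isOpen_basicOfNat (n : ℕ) : IsOpen (basicOfNat n) := by
  by_cases h : n % 2 = 0
  · rw [basicOfNat_of_even h]; exact isOpen_openRect _ _ _ _
  · rw [basicOfNat_of_odd h]; exact isOpen_diskExterior _

theorem isPreconnected_basicOfNat (n : ℕ) : IsPreconnected (basicOfNat n) := by
  by_cases h : n % 2 = 0
  · rw [basicOfNat_of_even h]; exact isPreconnected_openRect _ _ _ _
  · rw [basicOfNat_of_odd h]; exact isPreconnected_diskExterior (diskRadius_pos _)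

theorem nonempty_basicOfNat (n : ℕ) : (basicOfNat n).Nonempty := by
  by_cases h : n % 2 = 0
  · rw [basicOfNat_of_even h]
    obtain ⟨x, hx⟩ := exists_between (Rat.cast_lt (K := ℝ).2 (rectLeft_lt_rectRight n))
    obtain ⟨y, hy⟩ := exists_between (Rat.cast_lt (K := ℝ).2 (rectLower_lt_rectUpper n))
    exact ⟨((⟨x, y⟩ : ℂ) : RiemannSphere), coe_mem_openRect.2 ⟨hx.1, hx.2, hy.1, hy.2⟩⟩
  · rw [basicOfNat_of_odd h]; exact ⟨_, infty_mem_diskExterior⟩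

theorem isBasic_basicOfNat (n : ℕ) : IsBasic (basicOfNat n) := by
  have : basicOfNat n ∈ Set.range basicOfNat := ⟨n, rfl⟩
  rwa [range_basicOfNat] at this

theorem IsBasic.exists_basicOfNat {S : Set RiemannSphere} (h : IsBasic S) :
    ∃ n, basicOfNat n = S := by
  have : S ∈ Set.range basicOfNat := by rw [range_basicOfNat]; exact h
  exact this

/-! ### Grids -/

/-- The number of a rational of the form `(i - 2 (N + 1) ^ 2) / (N + 1)`. -/
def gridCoordinate (N i : ℕ) : ℕ :=
  Nat.pair (Nat.pair i (2 * ((N + 1) * (N + 1)))) N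

/-- The numbers of the cells of the `N`-th grid: the exterior of the disk of radius `N + 1`, and
overlapping squares of side length `2 / (N + 1)`. -/
def cellCode (N t : ℕ) : ℕ :=
  if t = 0 then 2 * Nat.pair N 0 + 1 else
    2 * Nat.pair (Nat.pair (gridCoordinate N (t - 1).unpair.1) (Nat.pair 1 N))
      (Nat.pair (gridCoordinate N (t - 1).unpair.2) (Nat.pair 1 N))

/-- The cells of the `N`-th grid with a number below this bound cover the sphere. -/
def cellBound (N : ℕ) : ℕ :=
  Nat.pair (4 * ((N + 1) * (N + 1))) (4 * ((N + 1) * (N + 1))) + 1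

theorem primrec_gridCoordinate : Primrec₂ gridCoordinate := by
  have hN : Primrec fun x : ℕ × ℕ => x.1 + 1 := Primrec.succ.comp Primrec.fst
  exact Primrec₂.natPair.comp (Primrec₂.natPair.comp Primrec.snd (Primrec.nat_mul.comp
    (Primrec.const 2) (Primrec.nat_mul.comp hN hN))) Primrec.fst

theorem primrec_cellCode : Primrec₂ cellCode := by
  have hs : Primrec fun x : ℕ × ℕ => (x.2 - 1).unpair :=
    Primrec.unpair.comp (Primrec.nat_sub.comp Primrec.snd (Primrec.const 1))
  have hl : Primrec fun x : ℕ × ℕ => Nat.pair 1 x.1 :=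
    Primrec₂.natPair.comp (Primrec.const 1) Primrec.fst
  exact Primrec.ite (Primrec.eq.comp Primrec.snd (Primrec.const 0))
    (Primrec.succ.comp (Primrec.nat_mul.comp (Primrec.const 2)
      (Primrec₂.natPair.comp Primrec.fst (Primrec.const 0))))
    (Primrec.nat_mul.comp (Primrec.const 2) (Primrec₂.natPair.comp
      (Primrec₂.natPair.comp (primrec_gridCoordinate.comp Primrec.fst (Primrec.fst.comp hs)) hl)
      (Primrec₂.natPair.comp (primrec_gridCoordinate.comp Primrec.fst (Primrec.snd.comp hs)) hl)))

theorem primrec_cellBound : Primrec cellBound := by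
  have hN : Primrec fun N : ℕ => 4 * ((N + 1) * (N + 1)) :=
    Primrec.nat_mul.comp (Primrec.const 4) (Primrec.nat_mul.comp Primrec.succ Primrec.succ)
  exact Primrec.succ.comp (Primrec₂.natPair.comp hN hN)

theorem ratOfNat_gridCoordinate (N i : ℕ) :
    ratOfNat (gridCoordinate N i) = ((i : ℚ) - 2 * ((N + 1) * (N + 1))) / (N + 1) := by
  simp [ratOfNat, gridCoordinate]

theorem basicOfNat_cellCode_zero (N : ℕ) : basicOfNat (cellCode N 0) = diskExterior (N + 1) := by
  have h : (2 * Nat.pair N 0 + 1) / 2 = Nat.pair N 0 := by omega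
  simp [cellCode, basicOfNat, h, posRatOfNat, Nat.add_mod]

theorem coe_mem_basicOfNat_cellCode_succ {N t : ℕ} {z : ℂ} :
    (z : RiemannSphere) ∈ basicOfNat (cellCode N (t + 1)) ↔
      ((t.unpair.1 : ℝ) - 2 * ((N + 1) * (N + 1)) < z.re * (N + 1) ∧
        z.re * (N + 1) < (t.unpair.1 : ℝ) - 2 * ((N + 1) * (N + 1)) + 2) ∧
      ((t.unpair.2 : ℝ) - 2 * ((N + 1) * (N + 1)) < z.im * (N + 1) ∧
        z.im * (N + 1) < (t.unpair.2 : ℝ) - 2 * ((N + 1) * (N + 1)) + 2) := by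
  have hN : (0 : ℝ) < N + 1 := by positivity
  have hb : basicOfNat (cellCode N (t + 1)) =
      openRect (ratOfNat (gridCoordinate N t.unpair.1))
        (ratOfNat (gridCoordinate N t.unpair.1) + 2 / (N + 1))
        (ratOfNat (gridCoordinate N t.unpair.2))
        (ratOfNat (gridCoordinate N t.unpair.2) + 2 / (N + 1)) := by
    have h2 : posRatOfNat (Nat.pair 1 N) = 2 / (N + 1) := by
      simp [posRatOfNat]; norm_num
    simp [cellCode, basicOfNat, rectOfNat, h2]
  rw [hb, coe_mem_openRect, ratOfNat_gridCoordinate, ratOfNat_gridCoordinate]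
  push_cast
  rw [← add_div, ← add_div, div_lt_iff₀ hN, lt_div_iff₀ hN, div_lt_iff₀ hN, lt_div_iff₀ hN,
    and_assoc]

theorem infty_notMem_basicOfNat_cellCode_succ {N t : ℕ} :
    (OnePoint.infty : RiemannSphere) ∉ basicOfNat (cellCode N (t + 1)) := by
  have h : cellCode N (t + 1) % 2 = 0 := by simp [cellCode]
  rw [basicOfNat_of_even h]
  exact infty_notMem_openRect

theorem exists_grid_index (N : ℕ) {x : ℝ} (hx : |x| ≤ N + 1) :
    ∃ i < 4 * ((N + 1) * (N + 1)), (i : ℝ) - 2 * ((N + 1) * (N + 1)) < x * (N + 1) ∧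
      x * (N + 1) < (i : ℝ) - 2 * ((N + 1) * (N + 1)) + 2 := by
  obtain ⟨h1, h2⟩ := abs_le.1 hx
  have hN : (1 : ℝ) ≤ N + 1 := by simp
  set M : ℕ := (N + 1) * (N + 1) with hM
  have hM' : (M : ℝ) = (N + 1) * (N + 1) := by rw [hM]; push_cast; ring
  have hM1 : 1 ≤ M := Nat.one_le_iff_ne_zero.2 (by positivity)
  have hlow : -(M : ℝ) ≤ x * (N + 1) := by rw [hM']; nlinarith
  have hupp : x * (N + 1) ≤ M := by rw [hM']; nlinarith
  have hc1 : ⌈x * (N + 1)⌉ ≤ (M : ℤ) := Int.ceil_le.2 (by exact_mod_cast hupp)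
  have hc2 : -(M : ℤ) ≤ ⌈x * (N + 1)⌉ := by
    have : (-(M : ℤ) : ℝ) ≤ (⌈x * (N + 1)⌉ : ℝ) := by
      push_cast; exact hlow.trans (Int.le_ceil _)
    exact_mod_cast this
  -- In units of `1 / (N + 1)` the intervals are `(j, j + 2)` with integral `j`; they overlap, and
  -- `j = ⌈x * (N + 1)⌉ - 1` puts the point strictly inside even when it is integral.
  obtain ⟨i, hi⟩ : ∃ i : ℕ, (i : ℤ) = ⌈x * (N + 1)⌉ - 1 + 2 * M :=
    ⟨(⌈x * (N + 1)⌉ - 1 + 2 * M).toNat, Int.toNat_of_nonneg (by omega)⟩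
  have hi' : (i : ℝ) = ⌈x * (N + 1)⌉ - 1 + 2 * M := by exact_mod_cast hi
  have h3 := Int.le_ceil (x * (N + 1 : ℝ))
  have h4 := Int.ceil_lt_add_one (x * (N + 1 : ℝ))
  refine ⟨i, by omega, ?_, ?_⟩
  · rw [← hM']; linarith
  · rw [← hM']; linarith

theorem exists_mem_cell (N : ℕ) (x : RiemannSphere) :
    ∃ t < cellBound N, x ∈ basicOfNat (cellCode N t) := by
  by_cases hx : x ∈ basicOfNat (cellCode N 0)
  · exact ⟨0, Nat.succ_pos _, hx⟩
  rw [basicOfNat_cellCode_zero] at hx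
  induction x using OnePoint.rec with
  | infty => exact absurd infty_mem_diskExterior hx
  | coe z =>
    rw [coe_mem_diskExterior, not_lt] at hx
    push_cast at hx
    obtain ⟨i, hi, hi'⟩ := exists_grid_index N ((Complex.abs_re_le_norm z).trans hx)
    obtain ⟨j, hj, hj'⟩ := exists_grid_index N ((Complex.abs_im_le_norm z).trans hx)
    -- The shift by one leaves the number `0` to the exterior cell.
    refine ⟨Nat.pair i j + 1, Nat.succ_lt_succ
      ((Nat.pair_lt_pair_left _ hi).trans (Nat.pair_lt_pair_right _ hj)), ?_⟩
    rw [coe_mem_basicOfNat_cellCode_succ, Nat.unpair_pair]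
    exact ⟨hi', hj'⟩

theorem norm_sub_lt_of_mem_cell {N t : ℕ} {z w : ℂ}
    (hz : (z : RiemannSphere) ∈ basicOfNat (cellCode N (t + 1)))
    (hw : (w : RiemannSphere) ∈ basicOfNat (cellCode N (t + 1))) : ‖z - w‖ < 4 / (N + 1) := by
  have hN : (0 : ℝ) < N + 1 := by positivity
  obtain ⟨⟨h1, h2⟩, h3, h4⟩ := coe_mem_basicOfNat_cellCode_succ.1 hz
  obtain ⟨⟨k1, k2⟩, k3, k4⟩ := coe_mem_basicOfNat_cellCode_succ.1 hw
  have hre : |(z - w).re| < 2 / (N + 1) := by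
    rw [Complex.sub_re, abs_lt, neg_lt, lt_div_iff₀ hN, lt_div_iff₀ hN]
    constructor <;> linarith
  have him : |(z - w).im| < 2 / (N + 1) := by
    rw [Complex.sub_im, abs_lt, neg_lt, lt_div_iff₀ hN, lt_div_iff₀ hN]
    constructor <;> linarith
  calc ‖z - w‖ ≤ |(z - w).re| + |(z - w).im| := Complex.norm_le_abs_re_add_abs_im _
    _ < 2 / (N + 1) + 2 / (N + 1) := add_lt_add hre him
    _ = 4 / (N + 1) := by ring

/-- The cells of fine grids that meet a small neighborhood of `x` are contained in a given
neighborhood of `x`. -/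
theorem exists_nhds_cell_subset {x : RiemannSphere} {W : Set RiemannSphere} (hW : W ∈ 𝓝 x) :
    ∃ W' ∈ 𝓝 x, ∃ N₀, ∀ N ≥ N₀, ∀ t, (basicOfNat (cellCode N t) ∩ W').Nonempty →
      basicOfNat (cellCode N t) ⊆ W := by
  induction x using OnePoint.rec with
  | infty =>
    obtain ⟨s, ⟨-, hs⟩, hsW⟩ := OnePoint.hasBasis_nhds_infty.mem_iff.1 hW
    obtain ⟨ρ, hρ⟩ := hs.isBounded.subset_closedBall 0
    have hfin : ∀ z : ℂ, ρ < ‖z‖ → (z : RiemannSphere) ∈ W := fun z hz =>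
      hsW (Or.inl ⟨z, fun hzs => by
        have := hρ hzs
        rw [mem_closedBall_zero_iff] at this
        linarith, rfl⟩)
    have hinf : (OnePoint.infty : RiemannSphere) ∈ W := hsW (Or.inr rfl)
    obtain ⟨N₀, hN₀⟩ := exists_nat_ge ρ
    -- Two points of a square cell are less than `4` apart, so a square with a point outside radius
    -- `ρ + 4` stays outside radius `ρ`.
    refine ⟨((fun z : ℂ => (z : RiemannSphere)) '' Metric.closedBall 0 (ρ + 4))ᶜ,
      (OnePoint.isOpen_compl_image_coe.2 ⟨Metric.isClosed_closedBall,
        isCompact_closedBall _ _⟩).mem_nhds OnePoint.infty_notMem_image_coe, N₀,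
      fun N hN t hne => ?_⟩
    have hN' : ρ ≤ N := hN₀.trans (by exact_mod_cast hN)
    cases t with
    | zero =>
      rw [basicOfNat_cellCode_zero]
      intro y hy
      induction y using OnePoint.rec with
      | infty => exact hinf
      | coe z =>
        rw [coe_mem_diskExterior] at hy
        push_cast at hy
        exact hfin z (by linarith)
    | succ t =>
      obtain ⟨y, hy, hyW⟩ := hne
      intro y' hy'
      induction y using OnePoint.rec with
      | infty => exact absurd hy infty_notMem_basicOfNat_cellCode_succ
      | coe w =>
        induction y' using OnePoint.rec with
        | infty => exact absurd hy' infty_notMem_basicOfNat_cellCode_succ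
        | coe z =>
          have hw : ρ + 4 < ‖w‖ := by
            by_contra! hle
            exact hyW ⟨w, mem_closedBall_zero_iff.2 hle, rfl⟩
          have h1 := norm_sub_lt_of_mem_cell hy hy'
          have h2 : (4 : ℝ) / (N + 1) ≤ 4 := div_le_self (by norm_num) (by simp)
          have h3 := norm_sub_norm_le w z
          exact hfin z (by linarith)
  | coe z =>
    rw [OnePoint.nhds_coe_eq, mem_map, Metric.mem_nhds_iff] at hW
    obtain ⟨ε, hε, hεW⟩ := hW
    -- `N₁` keeps the exterior cell away from the ball around `z`; `N₂` makes the square cells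
    -- smaller than `ε / 2`.
    obtain ⟨N₁, hN₁⟩ := exists_nat_ge (‖z‖ + ε)
    obtain ⟨N₂, hN₂⟩ := exists_nat_gt (8 / ε)
    refine ⟨(fun z : ℂ => (z : RiemannSphere)) '' Metric.ball z (ε / 2),
      (OnePoint.isOpen_image_coe.2 Metric.isOpen_ball).mem_nhds
        ⟨z, Metric.mem_ball_self (by linarith), rfl⟩, max N₁ N₂, fun N hN t hne => ?_⟩
    have hN1 : ‖z‖ + ε ≤ N := hN₁.trans (by exact_mod_cast (le_max_left _ _).trans hN)
    have hN2 : 8 / ε < N := hN₂.trans_le (by exact_mod_cast (le_max_right _ _).trans hN)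
    have hN3 : (4 : ℝ) / (N + 1) < ε / 2 := by
      rw [div_lt_iff₀ hε] at hN2
      rw [div_lt_iff₀ (by positivity)]
      linarith
    obtain ⟨_, hy, w, hw, rfl⟩ := hne
    rw [mem_ball_iff_norm] at hw
    cases t with
    | zero =>
      rw [basicOfNat_cellCode_zero, coe_mem_diskExterior] at hy
      push_cast at hy
      have := norm_sub_norm_le w z
      linarith
    | succ t =>
      intro y' hy'
      induction y' using OnePoint.rec with
      | infty => exact absurd hy' infty_notMem_basicOfNat_cellCode_succ
      | coe u =>
        refine hεW ?_
        rw [mem_ball_iff_norm]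
        have h1 := norm_sub_lt_of_mem_cell hy' hy
        have h2 := norm_sub_le_norm_sub_add_norm_sub u w z
        linarith

/-- A property that is shared by all sufficiently small basic sets near each point holds for all
cells of some grid. -/
theorem exists_forall_cell {G : ℕ → Prop}
    (hG : ∀ x : RiemannSphere, ∃ W ∈ 𝓝 x, ∀ k, basicOfNat k ⊆ W → G k) :
    ∃ N, ∀ t, G (cellCode N t) := by
  choose W hW hWG using hG
  choose W' hW' N₀ hN₀ using fun x => exists_nhds_cell_subset (hW x)
  obtain ⟨s, -, hs⟩ := isCompact_univ.elim_nhds_subcover W' fun x _ => hW' x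
  refine ⟨s.sup N₀, fun t => ?_⟩
  -- Any point of the cell lies in one of the finitely many neighborhoods, and the cell is then
  -- small enough for it. This works for every `t`, also beyond `cellBound`.
  obtain ⟨y, hy⟩ := nonempty_basicOfNat (cellCode (s.sup N₀) t)
  obtain ⟨x, hx, hyx⟩ := Set.mem_iUnion₂.1 (hs (Set.mem_univ y))
  exact hWG x _ (hN₀ x _ (Finset.le_sup hx) t ⟨y, hy, hyx⟩)

theorem exists_basicOfNat_subset {x : RiemannSphere} {W : Set RiemannSphere} (hW : W ∈ 𝓝 x) :
    ∃ k, x ∈ basicOfNat k ∧ basicOfNat k ⊆ W := by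
  obtain ⟨W', hW', N, hN⟩ := exists_nhds_cell_subset hW
  obtain ⟨t, -, ht⟩ := exists_mem_cell N x
  exact ⟨_, ht, hN N le_rfl t ⟨x, ht, mem_of_mem_nhds hW'⟩⟩

theorem exists_closure_basicOfNat_subset {x : RiemannSphere} {W : Set RiemannSphere}
    (hW : W ∈ 𝓝 x) : ∃ k, x ∈ basicOfNat k ∧ closure (basicOfNat k) ⊆ W := by
  obtain ⟨V, hV, hVc, hVW⟩ := exists_mem_nhds_isClosed_subset hW
  obtain ⟨k, hk, hkV⟩ := exists_basicOfNat_subset hV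
  exact ⟨k, hk, (closure_minimal hkV hVc).trans hVW⟩

/-! ### The relations enumerated by the machine -/

/-- With the oracle `A`, which holds the code of a machine in the cell `0` and its oracle in the
other even cells, the machine maps the points of the basic set `x.1` into the basic set `x.2`: this
is already determined by a finite list of basic sets that contain the basic set `x.1`. -/
def MapsBasic (A : ℕ → ℕ) (x : ℕ × ℕ) : Prop :=
  ∃ l : List ℕ, ∃ n e : ℕ, A 0 = e ∧
    (∀ i < l.length,
      (i % 2 = 0 ∧ (l.getD i 0 = 0 ∨ basicOfNat x.1 ⊆ basicOfNat (l.getD i 0 - 1))) ∨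
        (i % 2 = 1 ∧ A (i + 1) = l.getD i 0)) ∧
    x.2 + 1 ∈ (OracleCode.simulateNat e).eval (Nat.pair (Encodable.encode l) n)

/-- The list in the odd cells of `A` contains the basic set with the number `r`. -/
def ListsBasic (A : ℕ → ℕ) (r : ℕ) : Prop :=
  ∃ n, A (2 * n + 1) = r + 1

/-- A certificate that the basic set with the number `v` is contained in the image: it meets the
image of a basic set `r`, and is disjoint from the image of the boundary of `r`. -/
def ImageContainsBasic (A : ℕ → ℕ) (v : ℕ) : Prop :=
  ∃ r, ListsBasic A r ∧ (∃ c, basicOfNat c ⊆ basicOfNat r ∧ MapsBasic A (c, v)) ∧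
    ∃ N, ∀ t < cellBound N, Disjoint (basicOfNat (cellCode N t)) (basicOfNat r) ∨
      basicOfNat (cellCode N t) ⊆ basicOfNat r ∨
      ∃ v', MapsBasic A (cellCode N t, v') ∧ Disjoint (basicOfNat v') (basicOfNat v)

/-- A certificate that the closure of the basic set with the number `k` is contained in the
image. -/
def ImageCoversBasic (A : ℕ → ℕ) (k : ℕ) : Prop :=
  ∃ N, ∀ t < cellBound N, Disjoint (basicOfNat (cellCode N t)) (basicOfNat k) ∨
    ∃ v, ImageContainsBasic A v ∧ basicOfNat (cellCode N t) ⊆ basicOfNat v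

namespace OracleSemidecidable

variable {α : Type*} [Primcodable α] {g h : α → ℕ}

theorem basic_subset (hg : Primrec g) (hh : Primrec h) :
    OracleSemidecidable fun _ a => basicOfNat (g a) ⊆ basicOfNat (h a) :=
  of_primrecPred (primrecPred_basicOfNat_subset.comp (Primrec.pair hg hh))

theorem basic_disjoint (hg : Primrec g) (hh : Primrec h) :
    OracleSemidecidable fun _ a => Disjoint (basicOfNat (g a)) (basicOfNat (h a)) :=
  of_primrecPred (primrecPred_basicOfNat_disjoint.comp (Primrec.pair hg hh))

theorem query (hg : Primrec g) (hh : Primrec h) :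
    OracleSemidecidable fun A a => A (g a) = h a :=
  oracle_eq.comp (Primrec.pair hg hh)

/-- The code number is itself read from the oracle. Quantifying over it and testing `A 0 = e` leaves
the simulation as an oracle-free computation in `e`. -/
theorem mapsBasic : OracleSemidecidable MapsBasic := by
  let β := (((ℕ × ℕ) × List ℕ) × ℕ) × ℕ
  have hl : Primrec fun y : β => y.1.1.2 :=
    Primrec.snd.comp (Primrec.fst.comp Primrec.fst)
  have hl' : Primrec fun y : β × ℕ => y.1.1.1.2.getD y.2 0 :=
    (Primrec.list_getD 0).comp (hl.comp Primrec.fst) Primrec.snd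
  have hi (k : ℕ) : PrimrecPred fun y : β × ℕ => y.2 % 2 = k :=
    Primrec.eq.comp (Primrec.nat_mod.comp Primrec.snd (Primrec.const 2)) (Primrec.const k)
  have hx : Primrec fun y : β => y.1.1.1 := Primrec.fst.comp (Primrec.fst.comp Primrec.fst)
  have hq : OracleSemidecidable fun A (y : β) => A 0 = y.2 := query (Primrec.const 0) Primrec.snd
  have hc : OracleSemidecidable fun A (y : β) => ∀ i < y.1.1.2.length,
      (i % 2 = 0 ∧ (y.1.1.2.getD i 0 = 0 ∨
        basicOfNat y.1.1.1.1 ⊆ basicOfNat (y.1.1.2.getD i 0 - 1))) ∨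
        (i % 2 = 1 ∧ A (i + 1) = y.1.1.2.getD i 0) := by
    refine forall_lt (P := fun A (y : β × ℕ) => (y.2 % 2 = 0 ∧ (y.1.1.1.2.getD y.2 0 = 0 ∨
        basicOfNat y.1.1.1.1.1 ⊆ basicOfNat (y.1.1.1.2.getD y.2 0 - 1))) ∨
        (y.2 % 2 = 1 ∧ A (y.2 + 1) = y.1.1.1.2.getD y.2 0)) ?_ (Primrec.list_length.comp hl)
    refine or (and (of_primrecPred (hi 0)) (or
      (of_primrecPred (Primrec.eq.comp hl' (Primrec.const 0))) (basic_subset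
        (Primrec.fst.comp (hx.comp Primrec.fst)) (Primrec.nat_sub.comp hl' (Primrec.const 1)))))
      (and (of_primrecPred (hi 1)) (query (Primrec.succ.comp Primrec.snd) hl'))
  have he : OracleSemidecidable fun _ (y : β) => y.1.1.1.2 + 1 ∈
      (OracleCode.simulateNat y.2).eval (Nat.pair (Encodable.encode y.1.1.2) y.1.2) :=
    mem_eval.comp (f := fun y : β => ((OracleCode.simulateNat y.2,
      Nat.pair (Encodable.encode y.1.1.2) y.1.2), y.1.1.1.2 + 1)) <|
    Primrec.pair (Primrec.pair (OracleCode.primrec_simulateNat.comp Primrec.snd)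
      (Primrec₂.natPair.comp (Primrec.encode.comp hl) (Primrec.snd.comp Primrec.fst)))
      (Primrec.succ.comp (Primrec.snd.comp hx))
  exact (hq.and (hc.and he)).exists_nat.exists_nat.exists_list

theorem listsBasic : OracleSemidecidable ListsBasic :=
  exists_nat (P := fun A (y : ℕ × ℕ) => A (2 * y.2 + 1) = y.1 + 1) <|
    query (Primrec.succ.comp (Primrec.nat_mul.comp (Primrec.const 2) Primrec.snd))
      (Primrec.succ.comp Primrec.fst)

theorem imageContainsBasic : OracleSemidecidable ImageContainsBasic := by
  have h1 : OracleSemidecidable fun A (y : ℕ × ℕ) =>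
      ∃ c, basicOfNat c ⊆ basicOfNat y.2 ∧ MapsBasic A (c, y.1) :=
    exists_nat (P := fun A (y : (ℕ × ℕ) × ℕ) =>
        basicOfNat y.2 ⊆ basicOfNat y.1.2 ∧ MapsBasic A (y.2, y.1.1)) <|
      and (basic_subset Primrec.snd (Primrec.snd.comp Primrec.fst))
        (mapsBasic.comp (Primrec.pair Primrec.snd (Primrec.fst.comp Primrec.fst)))
  have hcell : Primrec fun y : ((ℕ × ℕ) × ℕ) × ℕ => cellCode y.1.2 y.2 :=
    primrec_cellCode.comp (Primrec.snd.comp Primrec.fst) Primrec.snd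
  have hr : Primrec fun y : ((ℕ × ℕ) × ℕ) × ℕ => y.1.1.2 :=
    Primrec.snd.comp (Primrec.fst.comp Primrec.fst)
  have hv : Primrec fun y : ((ℕ × ℕ) × ℕ) × ℕ => y.1.1.1 :=
    Primrec.fst.comp (Primrec.fst.comp Primrec.fst)
  have h2 : OracleSemidecidable fun A (y : ((ℕ × ℕ) × ℕ) × ℕ) => ∃ v',
      MapsBasic A (cellCode y.1.2 y.2, v') ∧ Disjoint (basicOfNat v') (basicOfNat y.1.1.1) :=
    exists_nat (P := fun A (y : (((ℕ × ℕ) × ℕ) × ℕ) × ℕ) =>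
        MapsBasic A (cellCode y.1.1.2 y.1.2, y.2) ∧
          Disjoint (basicOfNat y.2) (basicOfNat y.1.1.1.1)) <|
      and (mapsBasic.comp (Primrec.pair (hcell.comp Primrec.fst) Primrec.snd))
        (basic_disjoint Primrec.snd (hv.comp Primrec.fst))
  have h3 : OracleSemidecidable fun A (y : ℕ × ℕ) => ∃ N, ∀ t < cellBound N,
      Disjoint (basicOfNat (cellCode N t)) (basicOfNat y.2) ∨
      basicOfNat (cellCode N t) ⊆ basicOfNat y.2 ∨
      ∃ v', MapsBasic A (cellCode N t, v') ∧ Disjoint (basicOfNat v') (basicOfNat y.1) :=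
    exists_nat (forall_lt ((basic_disjoint hcell hr).or ((basic_subset hcell hr).or h2))
      (primrec_cellBound.comp Primrec.snd))
  exact exists_nat ((listsBasic.comp Primrec.snd).and (h1.and h3))

theorem imageCoversBasic : OracleSemidecidable ImageCoversBasic := by
  have hcell : Primrec fun y : (ℕ × ℕ) × ℕ => cellCode y.1.2 y.2 :=
    primrec_cellCode.comp (Primrec.snd.comp Primrec.fst) Primrec.snd
  have h : OracleSemidecidable fun A (y : (ℕ × ℕ) × ℕ) =>
      ∃ v, ImageContainsBasic A v ∧ basicOfNat (cellCode y.1.2 y.2) ⊆ basicOfNat v :=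
    exists_nat (P := fun A (y : ((ℕ × ℕ) × ℕ) × ℕ) =>
        ImageContainsBasic A y.2 ∧ basicOfNat (cellCode y.1.1.2 y.1.2) ⊆ basicOfNat y.2) <|
      and (imageContainsBasic.comp Primrec.snd) (basic_subset (hcell.comp Primrec.fst) Primrec.snd)
  exact exists_nat (forall_lt ((basic_disjoint hcell (Primrec.fst.comp Primrec.fst)).or h)
    (primrec_cellBound.comp Primrec.snd))

end OracleSemidecidable

/-! ### Names of points -/

/-- The entries of the list `l` in even positions, followed by all basic sets that contain `z`. -/
noncomputable def extendName (l : List ℕ) (z : RiemannSphere) (j : ℕ) : ℕ :=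
  open Classical in
  if 2 * j < l.length then l.getD (2 * j) 0
  else if z ∈ basicOfNat (j - l.length) then j - l.length + 1 else 0

/-- Order and repetition are free in a name, so any finite list of blanks and sets around `z` may
precede a complete list. -/
theorem isPointName_extendName {l : List ℕ} {z : RiemannSphere}
    (hl : ∀ j k, 2 * j < l.length → l.getD (2 * j) 0 = k + 1 → z ∈ basicOfNat k) :
    IsPointName (extendName l z) z := by
  ext S
  constructor
  · rintro ⟨j, k, hj, rfl⟩
    refine ⟨isBasic_basicOfNat k, ?_⟩
    unfold extendName at hj
    split_ifs at hj with h1 h2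
    · exact hl j k h1 hj
    · obtain rfl : j - l.length = k := by omega
      exact h2
  · rintro ⟨hS, hz⟩
    obtain ⟨k, rfl⟩ := hS.exists_basicOfNat
    refine ⟨k + l.length, k, ?_, rfl⟩
    have h1 : ¬ 2 * (k + l.length) < l.length := by omega
    simp [extendName, h1, hz]

section FunctionName

variable {D : Set RiemannSphere} {f : RiemannSphere → RiemannSphere} {X : Set ℕ} {e : OracleCode}
  {p : ℕ → ℕ}

theorem tapeJoin_functionNameSeq_zero : tapeJoin (functionNameSeq X e) p 0 = e.toNat := rfl

theorem tapeJoin_two_mul_add_one (a : ℕ → ℕ) (n : ℕ) : tapeJoin a p (2 * n + 1) = p n := by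
  have h : (2 * n + 1) / 2 = n := by omega
  simp [tapeJoin, h, Nat.add_mod]

theorem tapeJoin_functionNameSeq_succ {i : ℕ} (hi : i % 2 = 1) (a : ℕ → ℕ) :
    tapeJoin (functionNameSeq X e) p (i + 1) = tapeJoin a (charSeq X) i := by
  obtain ⟨j, rfl⟩ : ∃ j, i = 2 * j + 1 := ⟨i / 2, by omega⟩
  have h : (2 * j + 1 + 1) / 2 = j + 1 := by omega
  have h' : (2 * j + 1 + 1) % 2 = 0 := by omega
  rw [tapeJoin_two_mul_add_one]
  simp [tapeJoin, h, h', functionNameSeq]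

/-- Soundness: the certificate's list is the beginning of an honest tape for `z`, so the simulated
run is a genuine run of `e` and its output must list a set around `f z`. Nothing is claimed about
points of the cell outside `D`. -/
theorem MapsBasic.apply_mem (hname : IsFunctionName X e f D) {c v : ℕ}
    (h : MapsBasic (tapeJoin (functionNameSeq X e) p) (c, v)) {z : RiemannSphere} (hzD : z ∈ D)
    (hz : z ∈ basicOfNat c) : f z ∈ basicOfNat v := by
  obtain ⟨l, n, _, rfl, hl, hv⟩ := h
  rw [tapeJoin_functionNameSeq_zero, OracleCode.simulateNat_toNat] at hv
  have hpn : IsPointName (extendName l z) z := by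
    refine isPointName_extendName fun j k hj hk => ?_
    rcases hl (2 * j) hj with ⟨-, h | h⟩ | ⟨h, -⟩
    · omega
    · rw [hk] at h
      exact h hz
    · omega
  obtain ⟨q, hq, hqn⟩ := hname z hzD _ hpn
  have hmem : v + 1 ∈ e.eval (tapeJoin (extendName l z) (charSeq X)) n := by
    refine OracleCode.mem_eval_of_mem_evalList (fun i w hiw => ?_) e hv
    obtain ⟨hi, hw⟩ := List.getElem?_eq_some_iff.1 hiw
    have hg : l.getD i 0 = w := by simp [List.getD, hiw]
    rcases hl i hi with ⟨hi2, -⟩ | ⟨hi2, hA⟩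
    · have h1 : 2 * (i / 2) = i := by omega
      simp [tapeJoin, hi2, extendName, h1, hi, hw]
    · rw [← tapeJoin_functionNameSeq_succ (e := e) (p := p) hi2, hA, hg]
  have hS : basicOfNat v ∈ listedSets q := ⟨n, v, Part.mem_unique (hq n) hmem, rfl⟩
  rw [hqn] at hS
  exact hS.2

/-- Completeness, by the use principle. The number `v` may differ from `k`, since a name lists sets
and a set may have several numbers. -/
theorem IsFunctionName.exists_nhds_mapsBasic (hname : IsFunctionName X e f D) (p : ℕ → ℕ)
    {z : RiemannSphere} (hz : z ∈ D) {k : ℕ} (hk : f z ∈ basicOfNat k) :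
    ∃ v, basicOfNat v = basicOfNat k ∧ ∃ W ∈ 𝓝 z, ∀ c, basicOfNat c ⊆ W →
      MapsBasic (tapeJoin (functionNameSeq X e) p) (c, v) := by
  have hpn : IsPointName (extendName [] z) z := isPointName_extendName (by simp)
  obtain ⟨q, hq, hqn⟩ := hname z hz _ hpn
  have hS : basicOfNat k ∈ listedSets q := by
    rw [hqn]
    exact ⟨isBasic_basicOfNat k, hk⟩
  obtain ⟨n, v, hv, hvk⟩ := hS
  refine ⟨v, hvk, ?_⟩
  set A' := tapeJoin (extendName [] z) (charSeq X) with hA'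
  have hmem : v + 1 ∈ e.eval A' n := hv ▸ hq n
  obtain ⟨m, hm⟩ := (OracleCode.eventually_mem_evalList A' e hmem).exists
  have hget : ∀ i < m, (oraclePrefix A' m).getD i 0 = A' i := fun i hi => by
    simp [List.getD, oraclePrefix_getElem?_eq_some.2 ⟨hi, rfl⟩]
  -- `W` is the intersection of the basic sets listed in the finite prefix; odd cells and blanks
  -- impose no condition.
  refine ⟨⋂ i ∈ {i | i < m}, {y | i % 2 = 0 → A' i ≠ 0 → y ∈ basicOfNat (A' i - 1)}, ?_,
    fun c hc => ⟨oraclePrefix A' m, n, _, rfl, fun i hi => ?_, ?_⟩⟩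
  · refine (biInter_mem (Set.finite_lt_nat m)).2 fun i _ => ?_
    by_cases hi : i % 2 = 0 ∧ A' i ≠ 0
    · refine mem_of_superset ((isOpen_basicOfNat (A' i - 1)).mem_nhds ?_) fun y hy _ _ => hy
      have hmem : basicOfNat (A' i - 1) ∈ listedSets (extendName [] z) := by
        refine ⟨i / 2, A' i - 1, ?_, rfl⟩
        have : A' i = extendName [] z (i / 2) := by simp [hA', tapeJoin, hi.1]
        omega
      rw [hpn] at hmem
      exact hmem.2
    · exact mem_of_superset univ_mem fun y _ h1 h2 => absurd ⟨h1, h2⟩ hi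
  · rw [length_oraclePrefix] at hi
    rw [hget i hi]
    rcases Nat.mod_two_eq_zero_or_one i with h2 | h2
    · refine Or.inl ⟨h2, or_iff_not_imp_left.2 fun h0 y hy => ?_⟩
      exact Set.mem_iInter₂.1 (hc hy) i hi h2 h0
    · exact Or.inr ⟨h2, tapeJoin_functionNameSeq_succ h2 _⟩
  · rw [tapeJoin_functionNameSeq_zero, OracleCode.simulateNat_toNat]
    exact hm

end FunctionName

/-! ### Correctness -/

section Correctness

variable {D U : Set RiemannSphere} {f : RiemannSphere → RiemannSphere} {X : Set ℕ}
  {e : OracleCode} {p : ℕ → ℕ}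

theorem ListsBasic.closure_subset (hp : IsOpenName p U) {a : ℕ → ℕ} {r : ℕ}
    (h : ListsBasic (tapeJoin a p) r) : closure (basicOfNat r) ⊆ U := by
  obtain ⟨n, hn⟩ := h
  rw [tapeJoin_two_mul_add_one] at hn
  have hS : basicOfNat r ∈ listedSets p := ⟨n, r, hn, rfl⟩
  rw [hp] at hS
  exact hS.2

theorem IsOpenName.exists_listsBasic (hp : IsOpenName p U) (a : ℕ → ℕ) {k : ℕ}
    (h : closure (basicOfNat k) ⊆ U) :
    ∃ r, basicOfNat r = basicOfNat k ∧ ListsBasic (tapeJoin a p) r := by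
  have hS : basicOfNat k ∈ listedSets p := by
    rw [hp]
    exact ⟨isBasic_basicOfNat k, h⟩
  obtain ⟨n, r, hn, hr⟩ := hS
  exact ⟨r, hr, n, by rw [tapeJoin_two_mul_add_one, hn]⟩

/-- Within the connected set `v`, the image of `r` is nonempty, open, and closed because `v` misses
the image of the boundary. -/
theorem ImageContainsBasic.subset_image (hf : IsMeromorphicOn f D) (hn : IsNonconstantOn f D)
    (hname : IsFunctionName X e f D) (hUD : U ⊆ D) (hp : IsOpenName p U) {v : ℕ}
    (h : ImageContainsBasic (tapeJoin (functionNameSeq X e) p) v) :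
    basicOfNat v ⊆ f '' U := by
  obtain ⟨r, hr, ⟨c, hcr, hcv⟩, N, hN⟩ := h
  have hrU := hr.closure_subset hp
  have hrD : basicOfNat r ⊆ D := subset_closure.trans (hrU.trans hUD)
  -- A cell around a boundary point is neither disjoint from `r` nor contained in it, so only the
  -- third alternative remains. The cell may leave `D`, but the point lies in `U ⊆ D`.
  have hbd : ∀ x ∈ closure (basicOfNat r), x ∉ basicOfNat r → f x ∉ basicOfNat v := by
    intro x hx hxr
    obtain ⟨t, ht, hxt⟩ := exists_mem_cell N x
    rcases hN t ht with h | h | ⟨v', hv', hd⟩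
    · obtain ⟨y, hy⟩ := mem_closure_iff.1 hx _ (isOpen_basicOfNat _) hxt
      exact absurd hy.2 (Set.disjoint_left.1 h hy.1)
    · exact absurd (h hxt) hxr
    · exact Set.disjoint_left.1 hd (hv'.apply_mem hname (hUD (hrU hx)) hxt)
  have hopen : IsOpen (f '' basicOfNat r) := hf.isOpen_image hn (isOpen_basicOfNat r) hrD
  have hclosed : IsClosed (f '' closure (basicOfNat r)) :=
    (isClosed_closure.isCompact.image_of_continuousOn
      (hf.continuousOn.mono (hrU.trans hUD))).isClosed
  have hsub : basicOfNat v ⊆ f '' basicOfNat r := by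
    refine (isPreconnected_basicOfNat v).subset_of_closure_inter_subset hopen ?_ ?_
    · obtain ⟨z, hz⟩ := nonempty_basicOfNat c
      exact ⟨f z, hcv.apply_mem hname (hrD (hcr hz)) hz, z, hcr hz, rfl⟩
    · rintro y ⟨hy, hyv⟩
      obtain ⟨x, hx, rfl⟩ := closure_minimal (Set.image_mono subset_closure) hclosed hy
      by_contra hne
      exact hbd x hx (fun hxr => hne ⟨x, hxr, rfl⟩) hyv
  exact hsub.trans (Set.image_mono (subset_closure.trans hrU))

/-- Isolated fibres separate `f z` from the compact image of the boundary of a small `r`, and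
compactness of the sphere turns the pointwise evidence into one grid. -/
theorem exists_imageContainsBasic (hf : IsMeromorphicOn f D) (hn : IsNonconstantOn f D)
    (hname : IsFunctionName X e f D) (hU : IsOpen U) (hUD : U ⊆ D) (hp : IsOpenName p U)
    {y : RiemannSphere} (hy : y ∈ f '' U) :
    ∃ v, ImageContainsBasic (tapeJoin (functionNameSeq X e) p) v ∧ y ∈ basicOfNat v := by
  obtain ⟨z, hz, rfl⟩ := hy
  -- On this closure, which lies in `U`, the value `f z` is taken only at `z`.
  obtain ⟨k, hzk, hk⟩ := exists_closure_basicOfNat_subset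
    (inter_mem (hU.mem_nhds hz) (hf.eventually_eq_imp_eq hn (hUD hz)))
  obtain ⟨r, hrk, hr⟩ := hp.exists_listsBasic (functionNameSeq X e) (hk.trans Set.inter_subset_left)
  rw [← hrk] at hzk hk
  have hrD : closure (basicOfNat r) ⊆ D := (hk.trans Set.inter_subset_left).trans hUD
  let F := f '' (closure (basicOfNat r) \ basicOfNat r)
  have hF : IsClosed F :=
    ((isClosed_closure.sdiff (isOpen_basicOfNat r)).isCompact.image_of_continuousOn
      (hf.continuousOn.mono (Set.sdiff_subset.trans hrD))).isClosed
  have hzF : f z ∉ F := by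
    rintro ⟨x, ⟨hx, hxr⟩, hxz⟩
    exact hxr ((hk hx).2 hxz ▸ hzk)
  obtain ⟨j, hzj, hj⟩ := exists_closure_basicOfNat_subset (hF.isOpen_compl.mem_nhds hzF)
  obtain ⟨v, hvj, W, hW, hWm⟩ := hname.exists_nhds_mapsBasic p (hUD hz) hzj
  rw [← hvj] at hzj hj
  refine ⟨v, ⟨r, hr, ?_, ?_⟩, hzj⟩
  · obtain ⟨c, -, hc⟩ := exists_basicOfNat_subset
      (inter_mem hW ((isOpen_basicOfNat r).mem_nhds hzk))
    exact ⟨c, hc.trans Set.inter_subset_right, hWm c (hc.trans Set.inter_subset_left)⟩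
  · obtain ⟨N, hN⟩ := exists_forall_cell (G := fun c => Disjoint (basicOfNat c) (basicOfNat r) ∨
        basicOfNat c ⊆ basicOfNat r ∨ ∃ v', MapsBasic (tapeJoin (functionNameSeq X e) p) (c, v') ∧
          Disjoint (basicOfNat v') (basicOfNat v)) fun x => by
      by_cases hx : x ∈ basicOfNat r
      · exact ⟨_, (isOpen_basicOfNat r).mem_nhds hx, fun c hc => Or.inr (Or.inl hc)⟩
      by_cases hx' : x ∈ closure (basicOfNat r)
      -- The closure of `v`, not just `v`, was kept off the image of the boundary, which leaves room
      -- for a basic set around `f x` disjoint from `v`.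
      · have hfx : f x ∉ closure (basicOfNat v) := fun h => hj h ⟨x, ⟨hx', hx⟩, rfl⟩
        obtain ⟨i, hxi, hi⟩ := exists_basicOfNat_subset
          (isClosed_closure.isOpen_compl.mem_nhds hfx)
        obtain ⟨v', hv'i, W', hW', hWm'⟩ := hname.exists_nhds_mapsBasic p (hrD hx') hxi
        refine ⟨W', hW', fun c hc => Or.inr (Or.inr ⟨v', hWm' c hc, ?_⟩)⟩
        rw [hv'i]
        exact Set.disjoint_left.2 fun w hw hwv => hi hw (subset_closure hwv)
      · exact ⟨_, isClosed_closure.isOpen_compl.mem_nhds hx', fun c hc =>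
          Or.inl (Set.disjoint_left.2 fun w hw hwr => hc hw (subset_closure hwr))⟩
    exact ⟨N, fun t _ => hN t⟩

/-- The closure is covered exactly by cells that meet the basic set; compactness supplies a grid so
fine that each of these fits into one certified set. -/
theorem imageCoversBasic_iff (hf : IsMeromorphicOn f D) (hn : IsNonconstantOn f D)
    (hname : IsFunctionName X e f D) (hU : IsOpen U) (hUD : U ⊆ D) (hp : IsOpenName p U) (k : ℕ) :
    ImageCoversBasic (tapeJoin (functionNameSeq X e) p) k ↔ closure (basicOfNat k) ⊆ f '' U := by
  constructor
  · rintro ⟨N, hN⟩ x hx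
    obtain ⟨t, ht, hxt⟩ := exists_mem_cell N x
    rcases hN t ht with h | ⟨v, hv, hsub⟩
    · obtain ⟨y, hy⟩ := mem_closure_iff.1 hx _ (isOpen_basicOfNat _) hxt
      exact absurd hy.2 (Set.disjoint_left.1 h hy.1)
    · exact hv.subset_image hf hn hname hUD hp (hsub hxt)
  · intro h
    obtain ⟨N, hN⟩ := exists_forall_cell (G := fun c => Disjoint (basicOfNat c) (basicOfNat k) ∨
        ∃ v, ImageContainsBasic (tapeJoin (functionNameSeq X e) p) v ∧
          basicOfNat c ⊆ basicOfNat v) fun x => by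
      by_cases hx : x ∈ closure (basicOfNat k)
      · obtain ⟨v, hv, hxv⟩ := exists_imageContainsBasic hf hn hname hU hUD hp (h hx)
        exact ⟨_, (isOpen_basicOfNat v).mem_nhds hxv, fun c hc => Or.inr ⟨v, hv, hc⟩⟩
      · exact ⟨_, isClosed_closure.isOpen_compl.mem_nhds hx, fun c hc =>
          Or.inl (Set.disjoint_left.2 fun w hw hwr => hc hw (subset_closure hwr))⟩
    exact ⟨N, fun t _ => hN t⟩

end Correctness

/-- There is one machine that turns every name `(X, e)` of a non-constant meromorphic function `f` with
domain `D`, together with every name `p` of an open subset `U` of `D`, into a name of the (open) image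
`f '' U`. -/
theorem mainTheorem8 :
    ∃ M : OracleCode,
      ∀ (D : Set RiemannSphere) (f : RiemannSphere → RiemannSphere),
        IsMeromorphicOn f D → IsNonconstantOn f D →
      ∀ (X : Set ℕ) (e : OracleCode), IsFunctionName X e f D →
      ∀ (U : Set RiemannSphere), IsOpen U → U ⊆ D →
      ∀ p : ℕ → ℕ, IsOpenName p U →
        IsOpen (f '' U) ∧
          ∃ q : ℕ → ℕ, M.Computes (tapeJoin (functionNameSeq X e) p) q ∧
            IsOpenName q (f '' U) := by
  obtain ⟨M, hM⟩ := OracleSemidecidable.imageCoversBasic.exists_machine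
  refine ⟨M, fun D f hf hn X e hname U hU hUD p hp => ⟨hf.isOpen_image hn hU hUD, ?_⟩⟩
  obtain ⟨q, hq, hk⟩ := hM (tapeJoin (functionNameSeq X e) p)
  refine ⟨q, hq, ?_⟩
  ext S
  constructor
  · rintro ⟨n, k, hnk, rfl⟩
    exact ⟨isBasic_basicOfNat k,
      (imageCoversBasic_iff hf hn hname hU hUD hp k).1 ((hk k).2 ⟨n, hnk⟩)⟩
  · rintro ⟨hS, hSU⟩
    obtain ⟨k, rfl⟩ := hS.exists_basicOfNat
    obtain ⟨n, hnk⟩ := (hk k).1 ((imageCoversBasic_iff hf hn hname hU hUD hp k).2 hSU)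
    exact ⟨n, k, hnk, rfl⟩
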